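/- Consider $n$ qubits, of dimension $d=2^n$. A pure stabilizer state is a unit vector $\phi\in\mathbb{C}^d$ whose stabilizer in the $n$-qubit Pauli group has order $2^n$; a stabilizer state is a convex mixture of projectors $|\phi\rangle\langle\phi|$ on pure stabilizer states; a magic state is a density matrix that is not a stabilizer state. A magic witness is a Hermitian operator $W$ with $\mathrm{Tr}(W\sigma)\ge 0$ for all stabilizer states $\sigma$ and $\mathrm{Tr}(W\rho)<0$ for some magic state $\rho$; it detects the states $\rho$ with $\mathrm{Tr}(W\rho)<0$. It is of fidelity type if $W=\alpha I-|\psi\rangle\langle\psi|$ with $\alpha\in\mathbb{R}$ and $\psi$ a unit vector. (a) For every $n$ and every unit vector $\psi\in\mathbb{C}^d$ there is a pure stabilizer state $\phi$ with $|\langle\phi|\psi\rangle|^2\ge\frac{3}{d+2}$. (b) For every $n\ge 2$ (that is, $d>2$): (i) for every $\varepsilon>0$ there is a magic state $\rho$ with $\left|\mathrm{Tr}(\rho^2)-\frac{1}{d-1/2}\right|<\varepsilon$; (ii) there is $\delta>0$ such that every density matrix $\rho$ with $\mathrm{Tr}(\rho^2)<\frac{1}{d-1/2}+\delta$ satisfies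 $\langle\psi|\rho|\psi\rangle<\frac{3}{d+2}$ for every unit vector $\psi$, and is not detected by any fidelity-type magic witness; (iii) consequently, there exist unfaithful magic states: magic states that are not detected by any magic witness of the form $\alpha I-|\psi\rangle\langle\psi|$. -/

import Mathlib

open scoped Matrix ComplexOrder

namespace UnfaithfulMagic

/-- Labels of the computational basis of `n` qubits: bit strings of length `n`.
The Hilbert space has dimension `d = 2 ^ n`. -/
abbrev Bits (n : ℕ) : Type := Fin n → Fin 2

/-- Operators on `n` qubits, as matrices in the computational basis. -/
abbrev Op (n : ℕ) : Type := Matrix (Bits n) (Bits n) ℂ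

/-- The single-qubit Pauli matrices `I, X, Y, Z`. -/
def pauli : Fin 4 → Matrix (Fin 2) (Fin 2) ℂ :=
  ![!![1, 0; 0, 1], !![0, 1; 1, 0], !![0, -Complex.I; Complex.I, 0], !![1, 0; 0, -1]]

/-- The Pauli string `P_{p 0} ⊗ ⋯ ⊗ P_{p (n-1)}`. -/
def pauliString {n : ℕ} (p : Fin n → Fin 4) : Op n :=
  Matrix.of fun x y => ∏ i, pauli (p i) (x i) (y i)

/-- The `n`-qubit Pauli group: all `i ^ k P` with `P` a Pauli string. -/
def pauliGroup (n : ℕ) : Set (Op n) :=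
  {g | ∃ (k : ℕ) (p : Fin n → Fin 4), g = Complex.I ^ k • pauliString p}

/-- Unit vectors. -/
def IsUnitVector {n : ℕ} (ψ : Bits n → ℂ) : Prop :=
  star ψ ⬝ᵥ ψ = 1

/-- The projector `|ψ⟩⟨ψ|`. -/
def proj {n : ℕ} (ψ : Bits n → ℂ) : Op n :=
  Matrix.vecMulVec ψ (star ψ)

/-- Pure stabilizer states: unit vectors whose stabilizer in the Pauli group has the maximal
order `2 ^ n`. -/
def IsStabilizerVector {n : ℕ} (φ : Bits n → ℂ) : Prop :=
  IsUnitVector φ ∧ {g | g ∈ pauliGroup n ∧ g *ᵥ φ = φ}.ncard = 2 ^ n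

/-- Density matrices. -/
def IsState {n : ℕ} (ρ : Op n) : Prop :=
  ρ.PosSemidef ∧ ρ.trace = 1

/-- Stabilizer states: mixtures of pure stabilizer states. -/
def stab (n : ℕ) : Set (Op n) :=
  convexHull ℝ {ρ | ∃ φ : Bits n → ℂ, IsStabilizerVector φ ∧ ρ = proj φ}

/-- Magic states: states that are not mixtures of pure stabilizer states. -/
def IsMagic {n : ℕ} (ρ : Op n) : Prop :=
  IsState ρ ∧ ρ ∉ stab n

/-- The expectation value `Tr(W ρ)` (a real number for Hermitian `W` and `ρ`). -/
def expect {n : ℕ} (W ρ : Op n) : ℝ :=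
  (W * ρ).trace.re

/-- The purity `Tr(ρ²)`. -/
def purity {n : ℕ} (ρ : Op n) : ℝ :=
  (ρ * ρ).trace.re

/-- The fidelity `⟨ψ|ρ|ψ⟩` of a state with a pure state. -/
def fidelity {n : ℕ} (ρ : Op n) (ψ : Bits n → ℂ) : ℝ :=
  (star ψ ⬝ᵥ ρ *ᵥ ψ).re

/-- Magic witnesses: observables that are nonnegative on all stabilizer states and negative on
some magic state. -/
def IsMagicWitness {n : ℕ} (W : Op n) : Prop :=
  W.IsHermitian ∧ (∀ σ ∈ stab n, 0 ≤ expect W σ) ∧ ∃ ρ : Op n, IsMagic ρ ∧ expect W ρ < 0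

/-- The operator `α I - |ψ⟩⟨ψ|`. -/
def fidelityOp {n : ℕ} (α : ℝ) (ψ : Bits n → ℂ) : Op n :=
  (α : ℂ) • (1 : Op n) - proj ψ

/-- Some magic witness of the form `α I - |ψ⟩⟨ψ|` detects `ρ`. -/
def DetectedByFidelity {n : ℕ} (ρ : Op n) : Prop :=
  ∃ (α : ℝ) (ψ : Bits n → ℂ), IsUnitVector ψ ∧ IsMagicWitness (fidelityOp α ψ) ∧
    expect (fidelityOp α ψ) ρ < 0

end UnfaithfulMagic

/-! Write c(a) = ⟨ψ|P_a|ψ⟩ for Pauli labels a, which form a symplectic space over `ZMod 2`. A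
Lagrangian subspace L is a maximal commuting family of Pauli strings, and its normalized joint
eigenvectors are stabilizer vectors. If ψ has squared overlaps r_χ with this eigenbasis, then ∑_{a ∈
L} c(a)² = d ∑ r_χ², and the sum over a, b ∈ L of c(a) c(b) Re⟨ψ|P_a P_b|ψ⟩ is d² ∑ r_χ³. Summed
over all L, both sides depend only on how many Lagrangians contain the given labels
(`card_lagrangiansOver`) and on sums over all Paulis that are the same for every ψ. The counts yield
the ratio of third to second moments of a projective 3-design, so some L satisfies ∑ r_χ³ ≥ 3/(d+2)
∑ r_χ² (`exists_lagrangian_moment_le`). Hence some r_χ is at least 3/(d+2), which is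
`exists_stabilizer_fidelity_ge`.

A fidelity witness αI − |ψ⟩⟨ψ| must therefore have α ≥ 3/(d+2), so it misses every state whose
fidelities all lie below that value. By Cauchy-Schwarz for traceless parts (`fidelity_sub_sq_le`),
low purity forces low fidelity with every pure state.

Magic states of low purity come from another witness W, supported on two basis vectors
(`edgeWitness_nonneg`). Moving from I/d in the direction −W crosses the hyperplane Tr(Wρ) = 0 at
purity 1/(d − 1/2), and the states just beyond it are magic (`exists_magic_purity_near`). For d > 2
this purity is strictly below the threshold from Cauchy-Schwarz, which leaves room for δ. -/

namespace UnfaithfulMagic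

open Module

/-! ### Pauli strings and their symplectic labels -/

/-- Symplectic labels `(x, z)` of single-qubit Pauli matrices, as a `ZMod 2`-vector per qubit. -/
abbrev PauliLabel (n : ℕ) : Type := Fin n → ZMod 2 × ZMod 2

/-- The index of the Pauli matrix `X ^ x Z ^ z` (up to phase). -/
def pauliIndex (p : ZMod 2 × ZMod 2) : Fin 4 :=
  if p.1 = 0 then (if p.2 = 0 then 0 else 3) else (if p.2 = 0 then 1 else 2)

/-- The Hermitian Pauli string with symplectic label `a`. -/
def pauliOp {n : ℕ} (a : PauliLabel n) : Op n := pauliString fun i => pauliIndex (a i)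

lemma pauliIndex_injective : Function.Injective pauliIndex := by decide

lemma pauliIndex_surjective : Function.Surjective pauliIndex := by decide

lemma exists_pauliOp_eq {n : ℕ} (p : Fin n → Fin 4) :
    ∃ a : PauliLabel n, pauliString p = pauliOp a := by
  choose a ha using fun i => pauliIndex_surjective (p i)
  exact ⟨a, by simp [pauliOp, ha]⟩

/-- The sign character of `ZMod 2`. -/
def signChar (z : ZMod 2) : ℂ := if z = 0 then 1 else -1

lemma zmod_two_eq_zero_or_one : ∀ z : ZMod 2, z = 0 ∨ z = 1 := by decide

lemma signChar_add (a b : ZMod 2) : signChar (a + b) = signChar a * signChar b := by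
  rcases zmod_two_eq_zero_or_one a with rfl | rfl <;>
    rcases zmod_two_eq_zero_or_one b with rfl | rfl <;>
    simp [signChar, CharTwo.add_self_eq_zero]

lemma signChar_sum {ι : Type*} (s : Finset ι) (f : ι → ZMod 2) :
    signChar (∑ i ∈ s, f i) = ∏ i ∈ s, signChar (f i) := by
  classical
  induction s using Finset.induction_on with
  | empty => simp [signChar]
  | insert i s hi ih => rw [Finset.sum_insert hi, Finset.prod_insert hi, signChar_add, ih]

/-- The symplectic form of two single-qubit labels. -/
def localForm (p q : ZMod 2 × ZMod 2) : ZMod 2 := p.1 * q.2 + p.2 * q.1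

/-- The symplectic form on Pauli labels. -/
def symplectic (n : ℕ) : LinearMap.BilinForm (ZMod 2) (PauliLabel n) :=
  LinearMap.mk₂ (ZMod 2) (fun a b => ∑ i, localForm (a i) (b i))
    (fun a b c => by
      rw [← Finset.sum_add_distrib]; exact Finset.sum_congr rfl fun i _ => by
        simp only [localForm, Pi.add_apply, Prod.fst_add, Prod.snd_add]; ring)
    (fun r a b => by
      rw [smul_eq_mul, Finset.mul_sum]; exact Finset.sum_congr rfl fun i _ => by
        simp only [localForm, Pi.smul_apply, Prod.smul_fst, Prod.smul_snd, smul_eq_mul]; ring)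
    (fun a b c => by
      rw [← Finset.sum_add_distrib]; exact Finset.sum_congr rfl fun i _ => by
        simp only [localForm, Pi.add_apply, Prod.fst_add, Prod.snd_add]; ring)
    (fun r a b => by
      rw [smul_eq_mul, Finset.mul_sum]; exact Finset.sum_congr rfl fun i _ => by
        simp only [localForm, Pi.smul_apply, Prod.smul_fst, Prod.smul_snd, smul_eq_mul]; ring)

lemma symplectic_apply {n : ℕ} (a b : PauliLabel n) :
    symplectic n a b = ∑ i, localForm (a i) (b i) := rfl

lemma pauli_mul_comm (p q : ZMod 2 × ZMod 2) :
    pauli (pauliIndex p) * pauli (pauliIndex q) =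
      signChar (localForm p q) • (pauli (pauliIndex q) * pauli (pauliIndex p)) := by
  obtain ⟨a, b⟩ := p
  obtain ⟨c, d⟩ := q
  rcases zmod_two_eq_zero_or_one a with rfl | rfl <;>
    rcases zmod_two_eq_zero_or_one b with rfl | rfl <;>
    rcases zmod_two_eq_zero_or_one c with rfl | rfl <;>
    rcases zmod_two_eq_zero_or_one d with rfl | rfl <;>
    simp [pauli, pauliIndex, localForm, signChar, CharTwo.add_self_eq_zero]

lemma pauli_isHermitian (k : Fin 4) : (pauli k).IsHermitian := by
  fin_cases k <;> ext i j <;> fin_cases i <;> fin_cases j <;> simp [pauli]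

lemma pauli_mul_self (k : Fin 4) : pauli k * pauli k = 1 := by
  fin_cases k <;> ext i j <;> fin_cases i <;> fin_cases j <;> simp [pauli]

lemma trace_pauli_mul (k l : Fin 4) : (pauli k * pauli l).trace = if k = l then 2 else 0 := by
  fin_cases k <;> fin_cases l <;> simp [pauli, Matrix.trace_fin_two] <;> norm_num

lemma sum_pauli_mul (x y z w : Fin 2) :
    ∑ p : ZMod 2 × ZMod 2, pauli (pauliIndex p) x y * pauli (pauliIndex p) z w =
      if x = w ∧ y = z then 2 else 0 := by
  rw [Fintype.sum_bijective pauliIndex ⟨pauliIndex_injective, pauliIndex_surjective⟩ _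
    (fun k => pauli k x y * pauli k z w) (fun _ => rfl), Fin.sum_univ_four]
  fin_cases x <;> fin_cases y <;> fin_cases z <;> fin_cases w <;> simp [pauli] <;> norm_num

lemma pauli_eq_zero_or (k : Fin 4) (x y : Fin 2) :
    pauli k x y = 0 ∨ ∃ m : ℕ, pauli k x y = Complex.I ^ m := by
  fin_cases k <;> fin_cases x <;> fin_cases y <;> simp [pauli]
  all_goals first
    | (refine ⟨0, ?_⟩; simp; done)
    | (refine ⟨1, ?_⟩; simp; done)
    | (refine ⟨2, ?_⟩; simp; done)
    | (refine ⟨3, ?_⟩; simp [pow_succ])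

lemma pauli_monomial (k : Fin 4) {x y z : Fin 2} (hy : pauli k x y ≠ 0) (hz : pauli k x z ≠ 0) :
    y = z := by
  revert hy hz
  fin_cases k <;> fin_cases x <;> fin_cases y <;> fin_cases z <;> simp [pauli]

variable {n : ℕ}

lemma pauliString_mul_apply (p q : Fin n → Fin 4) (x y : Bits n) :
    (pauliString p * pauliString q) x y = ∏ i, (pauli (p i) * pauli (q i)) (x i) (y i) := by
  simp only [Matrix.mul_apply, pauliString, Matrix.of_apply, ← Finset.prod_mul_distrib]
  rw [Finset.prod_univ_sum]
  simp

lemma pauliOp_mul_comm (a b : PauliLabel n) :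
    pauliOp a * pauliOp b = signChar (symplectic n a b) • (pauliOp b * pauliOp a) := by
  ext x y
  simp only [pauliOp, pauliString_mul_apply, Matrix.smul_apply, smul_eq_mul, symplectic_apply,
    signChar_sum, ← Finset.prod_mul_distrib]
  exact Finset.prod_congr rfl fun i _ => by rw [pauli_mul_comm]; simp

lemma pauliOp_isHermitian (a : PauliLabel n) : (pauliOp a).IsHermitian := by
  ext x y
  simp only [pauliOp, pauliString, Matrix.conjTranspose_apply, Matrix.of_apply, star_prod]
  exact Finset.prod_congr rfl fun i _ => (pauli_isHermitian _).apply _ _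

lemma one_apply_eq_prod (x y : Bits n) :
    (1 : Op n) x y = ∏ i, (1 : Matrix (Fin 2) (Fin 2) ℂ) (x i) (y i) := by
  simp only [Matrix.one_apply, funext_iff, Finset.prod_ite_zero, Finset.mem_univ, true_imp_iff,
    Finset.prod_const_one]

lemma pauliOp_mul_self (a : PauliLabel n) : pauliOp a * pauliOp a = 1 := by
  ext x y
  simp only [pauliOp, pauliString_mul_apply, pauli_mul_self, one_apply_eq_prod]

lemma pauliOp_zero : pauliOp (0 : PauliLabel n) = 1 := by
  ext x y
  rw [one_apply_eq_prod]
  simp [pauliOp, pauliString, pauliIndex, pauli, Matrix.one_fin_two]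

lemma trace_pauliOp_mul (a b : PauliLabel n) :
    (pauliOp a * pauliOp b).trace = if a = b then 2 ^ n else 0 := by
  have h : (pauliOp a * pauliOp b).trace =
      ∏ i, (pauli (pauliIndex (a i)) * pauli (pauliIndex (b i))).trace := by
    simp only [Matrix.trace, Matrix.diag, pauliOp, pauliString_mul_apply]
    rw [Finset.prod_univ_sum]
    simp
  rw [h]
  simp only [trace_pauli_mul, pauliIndex_injective.eq_iff, Finset.prod_ite_zero, funext_iff,
    Finset.mem_univ, true_imp_iff, Finset.prod_const, Finset.card_univ, Fintype.card_fin]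

/-- This is the entrywise form of ∑ P_a ⊗ P_a = d · SWAP; it factors over the qubits. Completeness
of the Pauli basis follows from it. -/
lemma sum_pauliOp_mul (x y z w : Bits n) :
    ∑ a : PauliLabel n, pauliOp a x y * pauliOp a z w = if x = w ∧ y = z then 2 ^ n else 0 := by
  have h : ∑ a : PauliLabel n, pauliOp a x y * pauliOp a z w =
      ∏ i, ∑ p : ZMod 2 × ZMod 2,
        pauli (pauliIndex p) (x i) (y i) * pauli (pauliIndex p) (z i) (w i) := by
    rw [Finset.prod_univ_sum]
    simp [pauliOp, pauliString, Finset.prod_mul_distrib]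
  rw [h]
  simp only [sum_pauli_mul, Finset.prod_ite_zero, funext_iff, forall_and,
    Finset.mem_univ, true_imp_iff, Finset.prod_const, Finset.card_univ, Fintype.card_fin]

lemma pauliOp_eq_zero_or (a : PauliLabel n) (x y : Bits n) :
    pauliOp a x y = 0 ∨ ∃ m : ℕ, pauliOp a x y = Complex.I ^ m := by
  by_cases h : ∃ i, pauli (pauliIndex (a i)) (x i) (y i) = 0
  · obtain ⟨i, hi⟩ := h
    exact Or.inl (Finset.prod_eq_zero (Finset.mem_univ i) hi)
  · push Not at h
    choose m hm using fun i => (pauli_eq_zero_or (pauliIndex (a i)) (x i) (y i)).resolve_left (h i)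
    exact Or.inr ⟨∑ i, m i, by simp [pauliOp, pauliString, hm, Finset.prod_pow_eq_pow_sum]⟩

lemma pauliOp_monomial (a : PauliLabel n) {x y z : Bits n} (hy : pauliOp a x y ≠ 0)
    (hz : pauliOp a x z ≠ 0) : y = z := by
  simp only [pauliOp, pauliString, Matrix.of_apply, Finset.prod_ne_zero_iff, Finset.mem_univ,
    true_imp_iff] at hy hz
  exact funext fun i => pauli_monomial _ (hy i) (hz i)

/-! ### Pauli coefficients and stabilizer vectors -/

/-- The expectation value of the Pauli string with label `a` in the state `φ`. -/
noncomputable def pauliCoeff (φ : Bits n → ℂ) (a : PauliLabel n) : ℝ :=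
  (star φ ⬝ᵥ pauliOp a *ᵥ φ).re

lemma star_dotProduct_pauliOp_mulVec (φ : Bits n → ℂ) (a : PauliLabel n) :
    star φ ⬝ᵥ pauliOp a *ᵥ φ = (pauliCoeff φ a : ℂ) := by
  apply Complex.ext
  · simp [pauliCoeff]
  · simpa using (pauliOp_isHermitian a).im_star_dotProduct_mulVec_self φ

lemma sum_pauliCoeff_smul (φ : Bits n → ℂ) :
    ∑ a, (pauliCoeff φ a : ℂ) • pauliOp a = (2 ^ n : ℂ) • proj φ := by
  ext x y
  simp only [Matrix.sum_apply, Matrix.smul_apply, smul_eq_mul, ← star_dotProduct_pauliOp_mulVec,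
    proj, Matrix.vecMulVec_apply]
  calc ∑ a, (star φ ⬝ᵥ pauliOp a *ᵥ φ) * pauliOp a x y
      = ∑ a, ∑ z, ∑ w, star φ z * φ w * (pauliOp a x y * pauliOp a z w) := by
        refine Finset.sum_congr rfl fun a _ => ?_
        simp only [dotProduct, Matrix.mulVec, Finset.sum_mul, Finset.mul_sum]
        exact Finset.sum_congr rfl fun z _ => Finset.sum_congr rfl fun w _ => by ring
    _ = ∑ z, ∑ w, star φ z * φ w * ∑ a, pauliOp a x y * pauliOp a z w := by
        rw [Finset.sum_comm]
        refine Finset.sum_congr rfl fun z _ => ?_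
        rw [Finset.sum_comm]
        simp only [Finset.mul_sum]
    _ = 2 ^ n * (φ x * star φ y) := by
        simp only [sum_pauliOp_mul]
        rw [Finset.sum_eq_single y, Finset.sum_eq_single x]
        · simp; ring
        · intro w _ hw; simp [hw.symm]
        · simp
        · intro z _ hz; simp [hz.symm]
        · simp

lemma proj_mulVec (φ v : Bits n → ℂ) : proj φ *ᵥ v = (star φ ⬝ᵥ v) • φ := by
  ext x
  simp [proj, Matrix.vecMulVec_mulVec, mul_comm]

lemma sum_pauliCoeff_sq {φ : Bits n → ℂ} (hφ : IsUnitVector φ) :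
    ∑ a, pauliCoeff φ a ^ 2 = 2 ^ n := by
  have h := congrArg (fun A => star φ ⬝ᵥ A *ᵥ φ) (sum_pauliCoeff_smul φ)
  simp only [Matrix.sum_mulVec, dotProduct_sum, Matrix.smul_mulVec, dotProduct_smul,
    star_dotProduct_pauliOp_mulVec, proj_mulVec, smul_eq_mul] at h
  rw [show star φ ⬝ᵥ φ = 1 from hφ] at h
  have h' : ((∑ a, pauliCoeff φ a ^ 2 : ℝ) : ℂ) = ((2 ^ n : ℝ) : ℂ) := by
    push_cast
    simpa [sq] using h
  exact_mod_cast h'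

lemma pauliOp_mulVec_mulVec (a : PauliLabel n) (v : Bits n → ℂ) :
    pauliOp a *ᵥ (pauliOp a *ᵥ v) = v := by
  rw [Matrix.mulVec_mulVec, pauliOp_mul_self, Matrix.one_mulVec]

lemma star_pauliOp_mulVec_dotProduct (a : PauliLabel n) (v w : Bits n → ℂ) :
    star (pauliOp a *ᵥ v) ⬝ᵥ w = star v ⬝ᵥ (pauliOp a *ᵥ w) := by
  rw [Matrix.star_mulVec, (pauliOp_isHermitian a).eq, Matrix.dotProduct_mulVec]

/-- Equality case of Cauchy-Schwarz: with c the coefficient, ‖P_a φ − c φ‖² = 1 − c². -/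
lemma pauliOp_mulVec_of_sq_eq_one {φ : Bits n → ℂ} (hφ : IsUnitVector φ) {a : PauliLabel n}
    (h : pauliCoeff φ a ^ 2 = 1) : pauliOp a *ᵥ φ = (pauliCoeff φ a : ℂ) • φ := by
  rw [← sub_eq_zero, ← dotProduct_star_self_eq_zero]
  have h1 : (pauliCoeff φ a : ℂ) ^ 2 = 1 := by exact_mod_cast h
  rw [star_sub, star_smul, sub_dotProduct, dotProduct_sub, dotProduct_sub, smul_dotProduct,
    smul_dotProduct, dotProduct_smul, dotProduct_smul, star_pauliOp_mulVec_dotProduct,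
    star_pauliOp_mulVec_dotProduct, pauliOp_mulVec_mulVec, star_dotProduct_pauliOp_mulVec,
    show star φ ⬝ᵥ φ = 1 from hφ]
  simp only [smul_eq_mul, Complex.star_def, Complex.conj_ofReal]
  linear_combination -h1

lemma pauliCoeff_of_eigenvector {φ : Bits n → ℂ} (hφ : IsUnitVector φ) {a : PauliLabel n} {c : ℂ}
    (h : pauliOp a *ᵥ φ = c • φ) : (pauliCoeff φ a : ℂ) = c ∧ pauliCoeff φ a ^ 2 = 1 := by
  have h1 : (pauliCoeff φ a : ℂ) = c := by
    rw [← star_dotProduct_pauliOp_mulVec, h, dotProduct_smul, show star φ ⬝ᵥ φ = 1 from hφ]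
    simp
  refine ⟨h1, ?_⟩
  have h2 := star_pauliOp_mulVec_dotProduct a φ (pauliOp a *ᵥ φ)
  rw [pauliOp_mulVec_mulVec, h, ← h1, star_smul, smul_dotProduct, dotProduct_smul,
    show star φ ⬝ᵥ φ = 1 from hφ] at h2
  simp only [smul_eq_mul, Complex.star_def, Complex.conj_ofReal, mul_one] at h2
  rw [sq]
  exact_mod_cast h2

/-- A Pauli string with φ as an eigenvector has a real eigenvalue ±1, so exactly one phase turns it
into a stabilizer element. Counting group elements thus becomes counting labels. -/
lemma pauliGroup_stabilizer_eq_image {φ : Bits n → ℂ} (hφ : IsUnitVector φ) :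
    {g | g ∈ pauliGroup n ∧ g *ᵥ φ = φ} =
      (fun a => (pauliCoeff φ a : ℂ) • pauliOp a) '' {a | pauliCoeff φ a ^ 2 = 1} := by
  ext g
  constructor
  · rintro ⟨⟨k, p, rfl⟩, hg⟩
    obtain ⟨a, ha⟩ := exists_pauliOp_eq p
    rw [ha, Matrix.smul_mulVec] at hg
    have hI : Complex.I ^ k ≠ 0 := pow_ne_zero _ Complex.I_ne_zero
    have he : pauliOp a *ᵥ φ = (Complex.I ^ k)⁻¹ • φ := by
      conv_rhs => rw [← hg]
      rw [smul_smul, inv_mul_cancel₀ hI, one_smul]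
    obtain ⟨h1, h2⟩ := pauliCoeff_of_eigenvector hφ he
    refine ⟨a, h2, ?_⟩
    have h3 : (pauliCoeff φ a : ℂ) = Complex.I ^ k := by
      have h4 : (pauliCoeff φ a : ℂ) ^ 2 = 1 := by exact_mod_cast h2
      have h5 : (pauliCoeff φ a : ℂ) * Complex.I ^ k = 1 := by rw [h1, inv_mul_cancel₀ hI]
      linear_combination Complex.I ^ k * h4 - (pauliCoeff φ a : ℂ) * h5
    simp only [h3, ha]
  · rintro ⟨a, ha, rfl⟩
    have ha' : pauliCoeff φ a ^ 2 = 1 := ha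
    refine ⟨?_, ?_⟩
    · rcases sq_eq_one_iff.mp ha' with h | h
      · exact ⟨0, _, by simp [h]; rfl⟩
      · exact ⟨2, _, by simp [h]; rfl⟩
    · simp only [Matrix.smul_mulVec]
      rw [pauliOp_mulVec_of_sq_eq_one hφ ha', smul_smul]
      have h4 : (pauliCoeff φ a : ℂ) * pauliCoeff φ a = 1 := by
        rw [← sq]; exact_mod_cast ha'
      rw [h4, one_smul]

lemma smul_pauliOp_injOn (φ : Bits n → ℂ) :
    Set.InjOn (fun a => (pauliCoeff φ a : ℂ) • pauliOp a) {a | pauliCoeff φ a ^ 2 = 1} := by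
  intro a ha b _ hab
  by_contra hne
  have h := congrArg (fun A => (pauliOp a * A).trace) hab
  have ha' : pauliCoeff φ a ^ 2 = 1 := ha
  simp only [Matrix.mul_smul, Matrix.trace_smul, trace_pauliOp_mul, if_neg hne, if_true,
    smul_eq_mul, mul_zero] at h
  have : pauliCoeff φ a = 0 := by simpa using h
  simp [this] at ha'

/-- A unit vector is a stabilizer vector iff exactly `2 ^ n` Pauli strings stabilize it up to
sign. -/
lemma isStabilizerVector_iff {φ : Bits n → ℂ} :
    IsStabilizerVector φ ↔ IsUnitVector φ ∧ {a | pauliCoeff φ a ^ 2 = 1}.ncard = 2 ^ n := by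
  refine and_congr_right fun hφ => ?_
  rw [pauliGroup_stabilizer_eq_image hφ, (smul_pauliOp_injOn φ).ncard_image]

/-- If at least `2 ^ n` Pauli coefficients are `±1`, then all others vanish. -/
lemma pauliCoeff_eq_zero_of_notMem {φ : Bits n → ℂ} (hφ : IsUnitVector φ)
    {s : Finset (PauliLabel n)} (hs : ∀ a ∈ s, pauliCoeff φ a ^ 2 = 1) (hcard : s.card = 2 ^ n)
    {a : PauliLabel n} (ha : a ∉ s) : pauliCoeff φ a = 0 := by
  classical
  -- The squares sum to `2 ^ n`, and the labels in `s` already exhaust that total.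
  have h1 := sum_pauliCoeff_sq hφ
  rw [← Finset.sum_add_sum_compl s, Finset.sum_congr rfl hs, Finset.sum_const, hcard] at h1
  have h2 : ∑ a ∈ sᶜ, pauliCoeff φ a ^ 2 = 0 := by simpa using h1
  rw [Finset.sum_eq_zero_iff_of_nonneg fun _ _ => sq_nonneg _] at h2
  exact pow_eq_zero_iff two_ne_zero |>.mp (h2 a (by simpa using ha))

lemma IsStabilizerVector.pauliCoeff_eq_zero_or {φ : Bits n → ℂ} (hφ : IsStabilizerVector φ)
    (a : PauliLabel n) : pauliCoeff φ a = 0 ∨ pauliCoeff φ a ^ 2 = 1 := by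
  classical
  obtain ⟨hu, hc⟩ := isStabilizerVector_iff.mp hφ
  by_cases h : pauliCoeff φ a ^ 2 = 1
  · exact Or.inr h
  · refine Or.inl (pauliCoeff_eq_zero_of_notMem hu
      (s := Finset.univ.filter fun a => pauliCoeff φ a ^ 2 = 1) (by simp) ?_ (by simpa using h))
    rw [← hc, ← Set.ncard_coe_finset]
    simp

/-- Nonzero amplitudes of a stabilizer vector differ by fourth roots of unity. -/
lemma IsStabilizerVector.exists_eq_I_pow_mul {φ : Bits n → ℂ} (hφ : IsStabilizerVector φ)
    {x y : Bits n} (hx : φ x ≠ 0) (hy : φ y ≠ 0) : ∃ k : ℕ, φ x = Complex.I ^ k * φ y := by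
  -- The (x, y) entry of |φ⟩⟨φ| is nonzero, so its Pauli expansion contains a string that fixes φ up
  -- to sign and has a nonzero (x, y) entry. That string is monomial, so comparing x-components of
  -- the eigenvalue equation relates the two amplitudes.
  have h1 := congrFun (congrFun (sum_pauliCoeff_smul φ) x) y
  have h2 : ((2 ^ n : ℂ) • proj φ) x y ≠ 0 := by
    simp [proj, Matrix.vecMulVec_apply, hx, hy]
  rw [← h1, Matrix.sum_apply] at h2
  obtain ⟨a, -, ha⟩ := Finset.exists_ne_zero_of_sum_ne_zero h2
  simp only [Matrix.smul_apply, smul_eq_mul] at ha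
  have hc : pauliCoeff φ a ≠ 0 := fun h => ha (by simp [h])
  have hP : pauliOp a x y ≠ 0 := right_ne_zero_of_mul ha
  have hsq := (hφ.pauliCoeff_eq_zero_or a).resolve_left hc
  have he := congrFun (pauliOp_mulVec_of_sq_eq_one hφ.1 hsq) x
  have h3 : (pauliOp a *ᵥ φ) x = pauliOp a x y * φ y := by
    rw [Matrix.mulVec, dotProduct, Finset.sum_eq_single y]
    · intro z _ hz
      by_contra h
      exact hz (pauliOp_monomial a hP (left_ne_zero_of_mul h)).symm
    · simp
  obtain ⟨m, hm⟩ := (pauliOp_eq_zero_or a x y).resolve_left hP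
  rw [h3, hm] at he
  rcases sq_eq_one_iff.mp hsq with h | h
  · exact ⟨m, by simpa [h] using he.symm⟩
  · refine ⟨m + 2, ?_⟩
    rw [h] at he
    simp only [Complex.ofReal_neg, Complex.ofReal_one, neg_smul, one_smul, Pi.neg_apply] at he
    rw [pow_add, Complex.I_sq]
    linear_combination he

/-! ### Isotropic subspaces of the symplectic space -/

lemma symplectic_isAlt : (symplectic n).IsAlt := fun a => by
  rw [symplectic_apply]
  exact Finset.sum_eq_zero fun i _ => by
    rw [localForm, mul_comm, CharTwo.add_self_eq_zero]

lemma symplectic_comm (a b : PauliLabel n) : symplectic n a b = symplectic n b a := by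
  simp only [symplectic_apply, localForm]
  exact Finset.sum_congr rfl fun i _ => by ring

lemma symplectic_nondegenerate : (symplectic n).Nondegenerate := by
  have key : ∀ a : PauliLabel n, (∀ b, symplectic n a b = 0) → a = 0 := by
    intro a h
    funext i
    have h1 := h (Pi.single i (1, 0))
    have h2 := h (Pi.single i (0, 1))
    rw [symplectic_apply, Finset.sum_eq_single i] at h1 h2
    · simp [localForm] at h1 h2
      exact Prod.ext h2 h1
    all_goals simp +contextual [localForm]
  refine ⟨fun a h => key a h, fun a h => key a fun b => ?_⟩
  rw [symplectic_comm]; exact h b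

lemma finrank_pauliLabel : finrank (ZMod 2) (PauliLabel n) = 2 * n := by
  simp [finrank_pi_fintype, mul_comm]

/-- Subspaces on which the symplectic form vanishes. -/
def IsIsotropic (W : Submodule (ZMod 2) (PauliLabel n)) : Prop :=
  ∀ a ∈ W, ∀ b ∈ W, symplectic n a b = 0

lemma isIsotropic_iff_le_orthogonal {W : Submodule (ZMod 2) (PauliLabel n)} :
    IsIsotropic W ↔ W ≤ (symplectic n).orthogonal W :=
  ⟨fun h b hb a ha => h a ha b hb, fun h a ha _ hb => h hb a ha⟩

lemma finrank_orthogonal_add (W : Submodule (ZMod 2) (PauliLabel n)) :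
    finrank (ZMod 2) ((symplectic n).orthogonal W) + finrank (ZMod 2) W = 2 * n := by
  have h := LinearMap.BilinForm.finrank_orthogonal symplectic_nondegenerate W
  have h' := Submodule.finrank_le W
  rw [finrank_pauliLabel] at h h'
  omega

lemma IsIsotropic.finrank_le {W : Submodule (ZMod 2) (PauliLabel n)} (hW : IsIsotropic W) :
    finrank (ZMod 2) W ≤ n := by
  have h1 := Submodule.finrank_mono (isIsotropic_iff_le_orthogonal.mp hW)
  have h2 := finrank_orthogonal_add W
  omega

lemma ncard_submodule (W : Submodule (ZMod 2) (PauliLabel n)) :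
    (W : Set (PauliLabel n)).ncard = 2 ^ finrank (ZMod 2) W := by
  rw [← Nat.card_coe_set_eq]
  simpa using Module.natCard_eq_pow_finrank (K := ZMod 2) (V := W)

/-- Extending an isotropic subspace by an orthogonal vector. -/
lemma IsIsotropic.sup_span {W : Submodule (ZMod 2) (PauliLabel n)} (hW : IsIsotropic W)
    {v : PauliLabel n} (hv : v ∈ (symplectic n).orthogonal W) :
    IsIsotropic (W ⊔ Submodule.span (ZMod 2) {v}) := by
  intro a ha b hb
  obtain ⟨a', ha', _, hs, rfl⟩ := Submodule.mem_sup.mp ha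
  obtain ⟨s, rfl⟩ := Submodule.mem_span_singleton.mp hs
  obtain ⟨b', hb', _, ht, rfl⟩ := Submodule.mem_sup.mp hb
  obtain ⟨t, rfl⟩ := Submodule.mem_span_singleton.mp ht
  have h1 : symplectic n a' v = 0 := hv a' ha'
  have h2 : symplectic n v b' = 0 := by rw [symplectic_comm]; exact hv b' hb'
  have h3 : symplectic n v v = 0 := symplectic_isAlt v
  simp [h1, h2, h3, hW a' ha' b' hb']

lemma finrank_sup_span_singleton {W : Submodule (ZMod 2) (PauliLabel n)} {v : PauliLabel n}
    (hv : v ∉ W) :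
    finrank (ZMod 2) (W ⊔ Submodule.span (ZMod 2) {v} : Submodule (ZMod 2) (PauliLabel n)) =
      finrank (ZMod 2) W + 1 := by
  have h := Submodule.finrank_sup_add_finrank_inf_eq W (Submodule.span (ZMod 2) {v})
  have hv0 : v ≠ 0 := fun h => hv (h ▸ W.zero_mem)
  have hd : W ⊓ Submodule.span (ZMod 2) {v} = ⊥ :=
    ((Submodule.disjoint_span_singleton' hv0).mpr hv).eq_bot
  rw [hd, finrank_bot, finrank_span_singleton hv0] at h
  omega

/-! ### Counting Lagrangian subspaces -/

/-- Maximal isotropic subspaces. -/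
def IsLagrangian (L : Submodule (ZMod 2) (PauliLabel n)) : Prop :=
  IsIsotropic L ∧ finrank (ZMod 2) L = n

open Classical in
/-- The Lagrangian subspaces containing `W`. -/
noncomputable def lagrangiansOver (W : Submodule (ZMod 2) (PauliLabel n)) :
    Finset (Submodule (ZMod 2) (PauliLabel n)) :=
  (Set.toFinite {L | IsLagrangian L ∧ W ≤ L}).toFinset

lemma mem_lagrangiansOver {W L : Submodule (ZMod 2) (PauliLabel n)} :
    L ∈ lagrangiansOver W ↔ IsLagrangian L ∧ W ≤ L := by
  simp [lagrangiansOver]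

/-- The number of Lagrangian subspaces of a symplectic space of dimension `2 * m` over `ZMod 2`. -/
def lagrangianCount (m : ℕ) : ℕ := ∏ j ∈ Finset.range m, (2 ^ (j + 1) + 1)

lemma lagrangianCount_succ (m : ℕ) :
    lagrangianCount (m + 1) = lagrangianCount m * (2 ^ (m + 1) + 1) :=
  Finset.prod_range_succ _ _

lemma lagrangianCount_pos (m : ℕ) : 0 < lagrangianCount m :=
  Finset.prod_pos fun _ _ => by positivity

/-- Induction on the corank `m`, by counting pairs (L, v) with v ∈ L \ W in two ways. Each L has 2^n
− 2^k such v; each v ∈ W^⊥ \ W enlarges W to an isotropic space of rank one more. The quotient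
(4^(m+1) − 1)/(2^(m+1) − 1) = 2^(m+1) + 1 is the new factor. -/
lemma card_lagrangiansOver {W : Submodule (ZMod 2) (PauliLabel n)} (hW : IsIsotropic W) {m : ℕ}
    (hm : finrank (ZMod 2) W + m = n) : (lagrangiansOver W).card = lagrangianCount m := by
  classical
  induction m generalizing W with
  | zero =>
    rw [Finset.card_eq_one.mpr ⟨W, ?_⟩]
    · simp [lagrangianCount]
    · ext L
      rw [mem_lagrangiansOver, Finset.mem_singleton]
      constructor
      · rintro ⟨⟨-, h1⟩, h2⟩
        exact (Submodule.eq_of_le_of_finrank_eq h2 (by omega)).symm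
      · rintro rfl
        exact ⟨⟨hW, by omega⟩, le_rfl⟩
  | succ m ih =>
    set k := finrank (ZMod 2) W with hk
    set S : Finset (PauliLabel n) :=
      Finset.univ.filter fun v => v ∈ (symplectic n).orthogonal W ∧ v ∉ W with hS
    have card_diff : ∀ U : Submodule (ZMod 2) (PauliLabel n), W ≤ U →
        (Finset.univ.filter fun v => v ∈ U ∧ v ∉ W).card + 2 ^ k = 2 ^ finrank (ZMod 2) U := by
      intro U hU
      rw [← ncard_submodule U, hk, ← ncard_submodule W,
        ← Set.ncard_sdiff_add_ncard_of_subset (show (W : Set (PauliLabel n)) ⊆ U from hU),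
        ← Set.ncard_coe_finset]
      congr 2
      ext v
      simp
    have hdouble : ∑ L ∈ lagrangiansOver W, (Finset.univ.filter fun v => v ∈ L ∧ v ∉ W).card =
        ∑ v ∈ S, (lagrangiansOver (W ⊔ Submodule.span (ZMod 2) {v})).card := by
      refine Eq.trans ?_ ((Finset.sum_card_bipartiteAbove_eq_sum_card_bipartiteBelow
        (s := lagrangiansOver W) (t := S) (fun L v => v ∈ L)).trans ?_)
      · refine Finset.sum_congr rfl fun L hL => congrArg _ ?_
        obtain ⟨hL1, hL2⟩ := mem_lagrangiansOver.mp hL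
        ext v
        simp only [Finset.mem_filter, Finset.mem_univ, true_and, Finset.bipartiteAbove, hS]
        constructor
        · rintro ⟨h1, h2⟩
          exact ⟨⟨fun w hw => hL1.1 w (hL2 hw) v h1, h2⟩, h1⟩
        · rintro ⟨⟨-, h2⟩, h1⟩
          exact ⟨h1, h2⟩
      · refine Finset.sum_congr rfl fun v hv => congrArg _ ?_
        ext L
        simp only [Finset.bipartiteBelow, Finset.mem_filter, mem_lagrangiansOver, sup_le_iff,
          Submodule.span_singleton_le_iff_mem, and_assoc]
    have hleft : ∀ L ∈ lagrangiansOver W,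
        (Finset.univ.filter fun v => v ∈ L ∧ v ∉ W).card = 2 ^ n - 2 ^ k := by
      intro L hL
      obtain ⟨hL1, hL2⟩ := mem_lagrangiansOver.mp hL
      have := card_diff L hL2
      rw [hL1.2] at this
      omega
    have hright : ∀ v ∈ S,
        (lagrangiansOver (W ⊔ Submodule.span (ZMod 2) {v})).card = lagrangianCount m := by
      intro v hv
      simp only [hS, Finset.mem_filter, Finset.mem_univ, true_and] at hv
      refine ih (hW.sup_span hv.1) ?_
      rw [finrank_sup_span_singleton hv.2]
      omega
    rw [Finset.sum_congr rfl hleft, Finset.sum_congr rfl hright, Finset.sum_const,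
      Finset.sum_const, smul_eq_mul, smul_eq_mul] at hdouble
    have hScard := card_diff _ (isIsotropic_iff_le_orthogonal.mp hW)
    have hfr : finrank (ZMod 2) ((symplectic n).orthogonal W) = k + 2 * (m + 1) := by
      have := finrank_orthogonal_add W
      omega
    rw [hfr] at hScard
    have hn : 2 ^ n = 2 ^ k * 2 ^ (m + 1) := by rw [← hm, pow_add]
    have h2 : 2 ^ (k + 2 * (m + 1)) = 2 ^ k * (2 ^ (m + 1) * 2 ^ (m + 1)) := by
      rw [pow_add, two_mul, pow_add]
    have hk0 : 0 < 2 ^ k := by positivity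
    -- Writing 2^(m+1) = q + 2 turns 2^(m+1) ∓ 1 into q + 1 and q + 3, free of truncated
    -- subtraction.
    obtain ⟨q, hq⟩ : ∃ q, 2 ^ (m + 1) = q + 2 := by
      have := Nat.one_le_two_pow (n := m)
      exact ⟨2 ^ (m + 1) - 2, by omega⟩
    rw [lagrangianCount_succ, hq]
    have hSc : S.card = 2 ^ k * ((q + 1) * (q + 3)) := by
      rw [h2, hq] at hScard
      have : S.card + 2 ^ k = 2 ^ k * ((q + 1) * (q + 3)) + 2 ^ k := by rw [hScard]; ring
      omega
    have hd : 2 ^ n - 2 ^ k = 2 ^ k * (q + 1) := by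
      rw [hn, hq]
      have : 2 ^ k * (q + 2) = 2 ^ k * (q + 1) + 2 ^ k := by ring
      omega
    rw [hSc, hd] at hdouble
    refine Nat.eq_of_mul_eq_mul_right (show 0 < 2 ^ k * (q + 1) by positivity) ?_
    rw [hdouble]
    ring

/-- The number of Lagrangian subspaces containing two given commuting labels, by rank. -/
lemma card_lagrangiansOver_span_pair {a b : PauliLabel n} (hab : symplectic n a b = 0) :
    (lagrangiansOver (Submodule.span (ZMod 2) {a, b})).card =
      lagrangianCount (n - finrank (ZMod 2) (Submodule.span (ZMod 2) {a, b})) := by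
  have hW : IsIsotropic (Submodule.span (ZMod 2) {a, b}) := by
    have h0 : IsIsotropic (⊥ : Submodule (ZMod 2) (PauliLabel n)) := by
      intro x hx y _
      simp [(Submodule.mem_bot _).mp hx]
    have h1 := h0.sup_span (v := a) (fun x hx => by
      simp [(Submodule.mem_bot _).mp hx])
    rw [bot_sup_eq] at h1
    have h2 := h1.sup_span (v := b) (fun x hx => by
      obtain ⟨s, rfl⟩ := Submodule.mem_span_singleton.mp hx
      simp [hab])
    rwa [← Submodule.span_union, Set.singleton_union] at h2
  exact card_lagrangiansOver hW (by have := hW.finrank_le; omega)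

-- Over `ZMod 2` a pair is dependent iff a = 0, b = 0 or a = b. Exactly one of these holds in rank
-- one and all three in rank zero, so the coefficients interpolate the counts for ranks 2, 1 and 0.
-- Non-commuting pairs lie in no Lagrangian.
open Classical in
lemma card_lagrangiansOver_span_pair_eq (a b : PauliLabel n) :
    ((lagrangiansOver (Submodule.span (ZMod 2) {a, b})).card : ℝ) =
      (if symplectic n a b = 0 then (lagrangianCount (n - 2) : ℝ) else 0) +
      ((lagrangianCount (n - 1) : ℝ) - lagrangianCount (n - 2)) *
        ((if a = 0 then 1 else 0) + (if b = 0 then 1 else 0) + (if a = b then 1 else 0)) +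
      ((lagrangianCount n : ℝ) - 3 * lagrangianCount (n - 1) + 2 * lagrangianCount (n - 2)) *
        (if a = 0 then (if b = 0 then 1 else 0) else 0) := by
  by_cases hab : symplectic n a b = 0
  · rw [card_lagrangiansOver_span_pair hab, if_pos hab]
    by_cases ha : a = 0
    · subst ha
      by_cases hb : b = 0
      · subst hb
        have h0 : Submodule.span (ZMod 2) {(0 : PauliLabel n), 0} = ⊥ := by simp
        rw [h0, finrank_bot]
        simp
        ring
      · rw [Submodule.span_insert_zero, finrank_span_singleton hb]
        simp [hb, Ne.symm hb]
    · by_cases hb : b = 0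
      · subst hb
        rw [Set.pair_comm, Submodule.span_insert_zero, finrank_span_singleton ha]
        simp [ha]
      · by_cases h : a = b
        · subst h
          rw [Set.pair_eq_singleton, finrank_span_singleton ha]
          simp [ha]
        · have hr : finrank (ZMod 2) (Submodule.span (ZMod 2) {a, b}) = 2 := by
            have hni : b ∉ Submodule.span (ZMod 2) {a} := by
              rw [Submodule.mem_span_singleton]
              rintro ⟨s, hs⟩
              rcases zmod_two_eq_zero_or_one s with rfl | rfl
              · exact hb (by simpa using hs.symm)
              · exact h (by simpa using hs)
            have := finrank_sup_span_singleton hni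
            rwa [← Submodule.span_union, Set.singleton_union, finrank_span_singleton ha] at this
          rw [hr]
          simp [ha, hb, h]
  · have ha : a ≠ 0 := by rintro rfl; simp at hab
    have hb : b ≠ 0 := by rintro rfl; simp at hab
    have h : a ≠ b := by rintro rfl; exact hab (symplectic_isAlt a)
    have he : lagrangiansOver (Submodule.span (ZMod 2) {a, b}) = ∅ := by
      refine Finset.eq_empty_of_forall_notMem fun L hL => ?_
      obtain ⟨h1, h2⟩ := mem_lagrangiansOver.mp hL
      exact hab (h1.1 a (h2 (Submodule.subset_span (by simp))) b
        (h2 (Submodule.subset_span (by simp))))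
    simp [he, hab, ha, hb, h]

/-! ### Moments summed over all Lagrangians -/

/-- The weight `⟨P_a⟩ ⟨P_b⟩ Re ⟨P_a P_b⟩` of a pair of Pauli strings. -/
noncomputable def pauliPairCoeff (ψ : Bits n → ℂ) (a b : PauliLabel n) : ℝ :=
  pauliCoeff ψ a * pauliCoeff ψ b * (star ψ ⬝ᵥ (pauliOp a * pauliOp b) *ᵥ ψ).re

lemma pauliCoeff_zero {ψ : Bits n → ℂ} (hψ : IsUnitVector ψ) : pauliCoeff ψ 0 = 1 := by
  simp [pauliCoeff, pauliOp_zero, show star ψ ⬝ᵥ ψ = 1 from hψ]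

lemma pauliPairCoeff_zero_left {ψ : Bits n → ℂ} (hψ : IsUnitVector ψ) (b : PauliLabel n) :
    pauliPairCoeff ψ 0 b = pauliCoeff ψ b ^ 2 := by
  rw [pauliPairCoeff, pauliCoeff_zero hψ, pauliOp_zero, one_mul (pauliOp b),
    show (star ψ ⬝ᵥ pauliOp b *ᵥ ψ).re = pauliCoeff ψ b from rfl]
  ring

lemma pauliPairCoeff_zero_right {ψ : Bits n → ℂ} (hψ : IsUnitVector ψ) (a : PauliLabel n) :
    pauliPairCoeff ψ a 0 = pauliCoeff ψ a ^ 2 := by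
  rw [pauliPairCoeff, pauliCoeff_zero hψ, pauliOp_zero, mul_one (pauliOp a),
    show (star ψ ⬝ᵥ pauliOp a *ᵥ ψ).re = pauliCoeff ψ a from rfl]
  ring

lemma pauliPairCoeff_self {ψ : Bits n → ℂ} (hψ : IsUnitVector ψ) (a : PauliLabel n) :
    pauliPairCoeff ψ a a = pauliCoeff ψ a ^ 2 := by
  rw [pauliPairCoeff, pauliOp_mul_self]
  simp [show star ψ ⬝ᵥ ψ = 1 from hψ]
  ring

/-- Both sides are the expectation of (d |ψ⟩⟨ψ|)² in ψ. -/
lemma sum_pauliPairCoeff {ψ : Bits n → ℂ} (hψ : IsUnitVector ψ) :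
    ∑ a, ∑ b, pauliPairCoeff ψ a b = (2 ^ n) ^ 2 := by
  have h := congrArg (fun A => (star ψ ⬝ᵥ (A * A) *ᵥ ψ).re) (sum_pauliCoeff_smul ψ)
  simp only [Finset.sum_mul_sum, Matrix.sum_mulVec, dotProduct_sum, Complex.re_sum,
    Matrix.smul_mul, Matrix.mul_smul, smul_smul, Matrix.smul_mulVec, dotProduct_smul,
    ← Matrix.mulVec_mulVec ψ (proj ψ), proj_mulVec, show star ψ ⬝ᵥ ψ = 1 from hψ] at h
  have h2 : (((2 ^ n * 2 ^ n * 1 : ℂ) • (1 : ℂ)) • (1 : ℂ)).re = (2 ^ n : ℝ) ^ 2 := by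
    have : (((2 ^ n * 2 ^ n * 1 : ℂ) • (1 : ℂ)) • (1 : ℂ)) = (((2 ^ n) ^ 2 : ℝ) : ℂ) := by
      push_cast; simp; ring
    rw [this, Complex.ofReal_re]
  rw [← h2]
  have h3 : (((2 ^ n * 2 ^ n * 1 : ℂ) • (1 : ℂ)) • (1 : ℂ)) =
      (2 ^ n * 2 ^ n * (1 : ℂ) • (1 : ℂ)) • (1 : ℂ) := by simp
  rw [h3, ← h]
  refine Finset.sum_congr rfl fun a _ => Finset.sum_congr rfl fun b _ => ?_
  rw [pauliPairCoeff, smul_eq_mul, ← Complex.ofReal_mul, Complex.re_ofReal_mul]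
  ring

/-- Anticommuting pairs cancel on symmetrizing in a and b, since P_a P_b + P_b P_a = 0, so
restricting to commuting pairs does not change the total. -/
lemma sum_commuting_pauliPairCoeff {ψ : Bits n → ℂ} (hψ : IsUnitVector ψ) :
    ∑ a, ∑ b, (if symplectic n a b = 0 then 1 else 0) * pauliPairCoeff ψ a b = (2 ^ n) ^ 2 := by
  have h1 := sum_pauliPairCoeff hψ
  have h2 : ∑ a, ∑ b, pauliPairCoeff ψ b a = (2 ^ n) ^ 2 := by rw [Finset.sum_comm, h1]
  have h3 : ∀ a b, pauliPairCoeff ψ a b + pauliPairCoeff ψ b a =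
      2 * ((if symplectic n a b = 0 then 1 else 0) * pauliPairCoeff ψ a b) := by
    intro a b
    have h := pauliOp_mul_comm b a
    rw [symplectic_comm] at h
    simp only [pauliPairCoeff, h, signChar]
    split_ifs
    · simp; ring
    · simp [Matrix.neg_mulVec]; ring
  have h4 := congrArg₂ (· + ·) h1 h2
  simp only [← Finset.sum_add_distrib, h3, ← Finset.mul_sum] at h4
  linarith

open Classical in
lemma sum_lagrangians_pair (f : PauliLabel n → PauliLabel n → ℝ) :
    ∑ L ∈ lagrangiansOver (⊥ : Submodule (ZMod 2) (PauliLabel n)),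
        ∑ a with a ∈ L, ∑ b with b ∈ L, f a b =
      ∑ a, ∑ b, ((lagrangiansOver (Submodule.span (ZMod 2) {a, b})).card : ℝ) * f a b := by
  have h1 : ∀ a b : PauliLabel n,
      ((lagrangiansOver (Submodule.span (ZMod 2) {a, b})).card : ℝ) * f a b =
      ∑ L ∈ lagrangiansOver (⊥ : Submodule (ZMod 2) (PauliLabel n)),
        if a ∈ L then (if b ∈ L then f a b else 0) else 0 := by
    intro a b
    simp only [← ite_and]
    rw [← Finset.sum_filter, Finset.sum_const, nsmul_eq_mul]
    congr 3
    ext L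
    simp [mem_lagrangiansOver, Submodule.span_le, Set.insert_subset_iff]
  simp only [h1]
  have hc : ∀ a : PauliLabel n, ∑ b : PauliLabel n,
      ∑ L ∈ lagrangiansOver (⊥ : Submodule (ZMod 2) (PauliLabel n)),
        (if a ∈ L then (if b ∈ L then f a b else 0) else 0) =
      ∑ L ∈ lagrangiansOver (⊥ : Submodule (ZMod 2) (PauliLabel n)), ∑ b : PauliLabel n,
        (if a ∈ L then (if b ∈ L then f a b else 0) else 0) := fun a => Finset.sum_comm
  simp only [hc]
  rw [Finset.sum_comm]
  simp only [Finset.sum_filter]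
  refine Finset.sum_congr rfl fun L _ => Finset.sum_congr rfl fun a _ => ?_
  split_ifs <;> simp

open Classical in
lemma sum_lagrangians (f : PauliLabel n → ℝ) :
    ∑ L ∈ lagrangiansOver (⊥ : Submodule (ZMod 2) (PauliLabel n)), ∑ a with a ∈ L, f a =
      ∑ a, ((lagrangiansOver (Submodule.span (ZMod 2) {a, a})).card : ℝ) * f a := by
  have h := sum_lagrangians_pair fun a b : PauliLabel n => if a = b then f a else 0
  simp only [mul_ite, mul_zero, Finset.sum_ite_eq, Finset.mem_univ, if_true] at h
  rw [← h]
  refine Finset.sum_congr rfl fun L _ => Finset.sum_congr rfl fun a ha => ?_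
  rw [if_pos ha]

open Classical in
/-- Some Lagrangian subspace satisfies the third-versus-second moment inequality of a
complex projective 3-design. -/
lemma exists_lagrangian_moment_le {ψ : Bits n → ℂ} (hψ : IsUnitVector ψ) :
    ∃ L : Submodule (ZMod 2) (PauliLabel n), IsLagrangian L ∧
      3 * 2 ^ n / (2 ^ n + 2) * ∑ a with a ∈ L, pauliCoeff ψ a ^ 2 ≤
        ∑ a with a ∈ L, ∑ b with b ∈ L, pauliPairCoeff ψ a b := by
  have hbot : IsIsotropic (⊥ : Submodule (ZMod 2) (PauliLabel n)) := by
    intro x hx y _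
    simp [(Submodule.mem_bot _).mp hx]
  have hne : (lagrangiansOver (⊥ : Submodule (ZMod 2) (PauliLabel n))).Nonempty := by
    rw [← Finset.card_pos, card_lagrangiansOver hbot (m := n) (by simp)]
    exact lagrangianCount_pos n
  have h2 : ∑ L ∈ lagrangiansOver (⊥ : Submodule (ZMod 2) (PauliLabel n)),
      ∑ a with a ∈ L, pauliCoeff ψ a ^ 2 =
      (lagrangianCount (n - 1) : ℝ) * 2 ^ n + (lagrangianCount n - lagrangianCount (n - 1)) := by
    rw [sum_lagrangians]
    have h : ∀ a : PauliLabel n,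
        ((lagrangiansOver (Submodule.span (ZMod 2) {a, a})).card : ℝ) * pauliCoeff ψ a ^ 2 =
        (lagrangianCount (n - 1) : ℝ) * pauliCoeff ψ a ^ 2 +
          (if a = 0 then (lagrangianCount n - lagrangianCount (n - 1) : ℝ) * pauliCoeff ψ a ^ 2
            else 0) := by
      intro a
      rw [card_lagrangiansOver_span_pair_eq, if_pos (symplectic_isAlt a), if_pos (rfl : a = a)]
      split_ifs <;> ring
    simp only [h, Finset.sum_add_distrib, ← Finset.mul_sum, sum_pauliCoeff_sq hψ,
      Finset.sum_ite_eq', Finset.mem_univ, if_true, pauliCoeff_zero hψ]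
    ring
  have h3 : ∑ L ∈ lagrangiansOver (⊥ : Submodule (ZMod 2) (PauliLabel n)),
      ∑ a with a ∈ L, ∑ b with b ∈ L, pauliPairCoeff ψ a b =
      (lagrangianCount (n - 2) : ℝ) * (2 ^ n) ^ 2 +
        (lagrangianCount (n - 1) - lagrangianCount (n - 2)) * (3 * 2 ^ n) +
        (lagrangianCount n - 3 * lagrangianCount (n - 1) + 2 * lagrangianCount (n - 2)) := by
    rw [sum_lagrangians_pair]
    have h : ∀ a b : PauliLabel n,
        ((lagrangiansOver (Submodule.span (ZMod 2) {a, b})).card : ℝ) * pauliPairCoeff ψ a b =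
        (lagrangianCount (n - 2) : ℝ) *
          ((if symplectic n a b = 0 then 1 else 0) * pauliPairCoeff ψ a b) +
        (lagrangianCount (n - 1) - lagrangianCount (n - 2) : ℝ) *
          ((if a = 0 then pauliPairCoeff ψ a b else 0) + (if b = 0 then pauliPairCoeff ψ a b else 0)
            + (if a = b then pauliPairCoeff ψ a b else 0)) +
        (lagrangianCount n - 3 * lagrangianCount (n - 1) + 2 * lagrangianCount (n - 2) : ℝ) *
          (if a = 0 then (if b = 0 then pauliPairCoeff ψ a b else 0) else 0) := by
      intro a b
      rw [card_lagrangiansOver_span_pair_eq]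
      split_ifs <;> ring
    have h0 : ∑ a, ∑ b, (if a = 0 then pauliPairCoeff ψ a b else 0) = 2 ^ n := by
      rw [Finset.sum_comm]
      simp [pauliPairCoeff_zero_left hψ, sum_pauliCoeff_sq hψ]
    simp only [h, Finset.sum_add_distrib, ← Finset.mul_sum, sum_commuting_pauliPairCoeff hψ, h0]
    have h00 : ∑ a : PauliLabel n, ∑ b : PauliLabel n,
        (if a = 0 then (if b = 0 then pauliPairCoeff ψ a b else 0) else 0) = 1 := by
      rw [Finset.sum_comm]
      simp [pauliPairCoeff_zero_left hψ, pauliCoeff_zero hψ]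
    rw [h00]
    simp only [Finset.sum_ite_eq, Finset.sum_ite_eq', Finset.mem_univ, if_true,
      pauliPairCoeff_zero_right hψ, pauliPairCoeff_self hψ, sum_pauliCoeff_sq hψ]
    ring
  have hle : ∑ L ∈ lagrangiansOver (⊥ : Submodule (ZMod 2) (PauliLabel n)),
        3 * 2 ^ n / (2 ^ n + 2) * ∑ a with a ∈ L, pauliCoeff ψ a ^ 2 ≤
      ∑ L ∈ lagrangiansOver (⊥ : Submodule (ZMod 2) (PauliLabel n)),
        ∑ a with a ∈ L, ∑ b with b ∈ L, pauliPairCoeff ψ a b := by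
    rw [← Finset.mul_sum, h2, h3]
    -- For n = 0, 1 the indices `n - 1`, `n - 2` may truncate, so these cases are evaluated
    -- directly. From n = 2 on the two sides are equal by the recursion for the counts.
    match n with
    | 0 => norm_num [lagrangianCount]
    | 1 => norm_num [lagrangianCount]
    | m + 2 =>
      have e1 : m + 2 - 1 = m + 1 := rfl
      have e2 : m + 2 - 2 = m := rfl
      rw [e1, e2, lagrangianCount_succ (m + 1), lagrangianCount_succ m]
      push_cast
      refine le_of_eq ?_
      have : (2 : ℝ) ^ (m + 2) + 2 ≠ 0 := by positivity
      field_simp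
      ring
  obtain ⟨L, hL, h⟩ := Finset.exists_le_of_sum_le hne hle
  exact ⟨L, (mem_lagrangiansOver.mp hL).1, h⟩

/-! ### Stabilizer bases and the fidelity bound -/

/-- Joint spectral decomposition of a vector with respect to an isotropic family of Pauli
strings. -/
lemma exists_joint_eigenvector_decomposition {L : Submodule (ZMod 2) (PauliLabel n)}
    (hL : IsIsotropic L) (ψ : Bits n → ℂ) :
    ∃ (s : Finset (L → ℂ)) (v : (L → ℂ) → Bits n → ℂ),
      (∀ χ (a : L), pauliOp (a : PauliLabel n) *ᵥ v χ = χ a • v χ) ∧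
      (∀ χ η, χ ≠ η → star (v χ) ⬝ᵥ v η = 0) ∧ ∑ χ ∈ s, v χ = ψ := by
  classical
  set T : L → EuclideanSpace ℂ (Bits n) →ₗ[ℂ] EuclideanSpace ℂ (Bits n) :=
    fun a => Matrix.toEuclideanLin (pauliOp (a : PauliLabel n)) with hT
  have hsymm : ∀ a, (T a).IsSymmetric := fun a =>
    Matrix.isSymmetric_toEuclideanLin_iff.mpr (pauliOp_isHermitian _)
  have hcomm : Pairwise (Function.onFun Commute T) := by
    intro a b _
    have h := pauliOp_mul_comm (a : PauliLabel n) b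
    rw [hL a a.2 b b.2] at h
    simp only [signChar, if_true, one_smul] at h
    refine LinearMap.ext fun x => ?_
    simp [hT, Matrix.toLpLin_apply, Matrix.mulVec_mulVec, h]
  have htop := LinearMap.IsSymmetric.iSup_iInf_eq_top_of_commute hsymm hcomm
  have hmem : WithLp.toLp 2 ψ ∈ ⨆ χ : L → ℂ, ⨅ a, End.eigenspace (T a) (χ a) := by
    rw [htop]; trivial
  rw [Submodule.mem_iSup_iff_exists_finsupp] at hmem
  obtain ⟨f, hf, hsum⟩ := hmem
  refine ⟨f.support, fun χ => (f χ).ofLp, fun χ a => ?_, fun χ η hne => ?_, ?_⟩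
  · have h := End.mem_eigenspace_iff.mp ((Submodule.mem_iInf _).mp (hf χ) a)
    simpa [hT, Matrix.toLpLin_apply] using congrArg WithLp.ofLp h
  · have h := (LinearMap.IsSymmetric.orthogonalFamily_iInf_eigenspaces hsymm) hne
      ⟨f χ, hf χ⟩ ⟨f η, hf η⟩
    simpa [EuclideanSpace.inner_eq_star_dotProduct, dotProduct_comm] using h
  · have h := congrArg WithLp.ofLp hsum
    simpa [Finsupp.sum] using h

/-- The `2 ^ n` labels of L all have coefficient ±1, which leaves no weight for any other label. -/
lemma isStabilizerVector_of_lagrangian {L : Submodule (ZMod 2) (PauliLabel n)}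
    (hL : IsLagrangian L) {φ : Bits n → ℂ} (hφ : IsUnitVector φ) {χ : L → ℂ}
    (h : ∀ a : L, pauliOp (a : PauliLabel n) *ᵥ φ = χ a • φ) :
    IsStabilizerVector φ ∧ ∀ a ∉ L, pauliCoeff φ a = 0 := by
  classical
  set s : Finset (PauliLabel n) := Finset.univ.filter (· ∈ L) with hs
  have hcard : s.card = 2 ^ n := by
    rw [← Set.ncard_coe_finset, ← congrArg (2 ^ ·) hL.2, ← ncard_submodule]
    congr 1
    ext; simp [hs]
  have h1 : ∀ a ∈ s, pauliCoeff φ a ^ 2 = 1 := fun a ha =>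
    (pauliCoeff_of_eigenvector hφ (h ⟨a, by simpa [hs] using ha⟩)).2
  have h0 : ∀ a ∉ L, pauliCoeff φ a = 0 := fun a ha =>
    pauliCoeff_eq_zero_of_notMem hφ h1 hcard (by simpa [hs] using ha)
  refine ⟨isStabilizerVector_iff.mpr ⟨hφ, ?_⟩, h0⟩
  rw [← hcard, ← Set.ncard_coe_finset]
  congr 1
  ext a
  constructor
  · intro ha
    by_contra hn
    have ha' : pauliCoeff φ a ^ 2 = 1 := ha
    rw [h0 a (by simpa [hs] using hn)] at ha'
    norm_num at ha'
  · intro ha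
    exact h1 a ha

lemma star_dotProduct_self_eq_ofReal (v : Bits n → ℂ) :
    star v ⬝ᵥ v = ((∑ x, ‖v x‖ ^ 2 : ℝ) : ℂ) := by
  simp only [dotProduct, Pi.star_apply, Complex.star_def, Complex.ofReal_sum]
  exact Finset.sum_congr rfl fun x _ => by rw [Complex.conj_mul']; push_cast; rfl

open Classical in
/-- The stabilizer vectors of a Lagrangian subspace diagonalize the pinching of `|ψ⟩⟨ψ|`. -/
lemma sum_pauliCoeff_smul_mulVec {L : Submodule (ZMod 2) (PauliLabel n)} (hL : IsLagrangian L)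
    (ψ : Bits n → ℂ) {φ : Bits n → ℂ} (hφ : IsUnitVector φ) {χ : L → ℂ}
    (h : ∀ a : L, pauliOp (a : PauliLabel n) *ᵥ φ = χ a • φ) :
    (∑ a with a ∈ L, (pauliCoeff ψ a : ℂ) • pauliOp a) *ᵥ φ =
      ((2 ^ n * ‖star φ ⬝ᵥ ψ‖ ^ 2 : ℝ) : ℂ) • φ := by
  obtain ⟨-, h0⟩ := isStabilizerVector_of_lagrangian hL hφ h
  -- The expansion of |φ⟩⟨φ|, evaluated in ψ, gives d |⟨φ|ψ⟩|² as a sum over labels; only those in L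
  -- survive, with the eigenvalues of φ as coefficients.
  have hexp := congrArg (fun A => star ψ ⬝ᵥ A *ᵥ ψ) (sum_pauliCoeff_smul φ)
  simp only [Matrix.sum_mulVec, dotProduct_sum, Matrix.smul_mulVec, dotProduct_smul,
    star_dotProduct_pauliOp_mulVec, proj_mulVec, smul_eq_mul] at hexp
  have hF : star φ ⬝ᵥ ψ * (star ψ ⬝ᵥ φ) = ((‖star φ ⬝ᵥ ψ‖ ^ 2 : ℝ) : ℂ) := by
    have : star ψ ⬝ᵥ φ = star (star φ ⬝ᵥ ψ) := Matrix.star_dotProduct _ _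
    rw [this, Complex.star_def, Complex.mul_conj']
    push_cast; rfl
  rw [hF] at hexp
  rw [Matrix.sum_mulVec, Complex.ofReal_mul]
  push_cast at hexp ⊢
  rw [← hexp, Finset.sum_smul, Finset.sum_filter]
  refine Finset.sum_congr rfl fun a _ => ?_
  split_ifs with ha
  · rw [Matrix.smul_mulVec, h ⟨a, ha⟩, ← (pauliCoeff_of_eigenvector hφ (h ⟨a, ha⟩)).1, smul_smul,
      mul_comm]
  · simp [h0 a ha]

/-- Every pure state has stabilizer fidelity at least `3 / (d + 2)`. -/
theorem exists_stabilizer_fidelity_ge {ψ : Bits n → ℂ} (hψ : IsUnitVector ψ) :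
    ∃ φ : Bits n → ℂ, IsStabilizerVector φ ∧ 3 / ((2 : ℝ) ^ n + 2) ≤ ‖star φ ⬝ᵥ ψ‖ ^ 2 := by
  classical
  by_contra! hcon
  obtain ⟨L, hL, hmom⟩ := exists_lagrangian_moment_le hψ
  obtain ⟨s, v, heig, horth, hsum⟩ := exists_joint_eigenvector_decomposition hL.1 ψ
  set M : Op n := ∑ a with a ∈ L, (pauliCoeff ψ a : ℂ) • pauliOp a with hM
  set r : (L → ℂ) → ℝ := fun χ => ∑ x, ‖v χ x‖ ^ 2 with hr
  have hr0 : ∀ χ, 0 ≤ r χ := fun χ => Finset.sum_nonneg fun _ _ => sq_nonneg _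
  have hvv : ∀ χ, star (v χ) ⬝ᵥ v χ = (r χ : ℂ) := fun χ => star_dotProduct_self_eq_ofReal _
  have hvψ : ∀ χ ∈ s, star (v χ) ⬝ᵥ ψ = (r χ : ℂ) := by
    intro χ hχ
    rw [← hsum, dotProduct_sum, Finset.sum_eq_single χ, hvv]
    · exact fun η _ hη => horth χ η hη.symm
    · exact fun h => absurd hχ h
  have hψv : ∀ χ ∈ s, star ψ ⬝ᵥ v χ = (r χ : ℂ) := by
    intro χ hχ
    have : star ψ ⬝ᵥ v χ = star (star (v χ) ⬝ᵥ ψ) := Matrix.star_dotProduct _ _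
    rw [this, hvψ χ hχ, Complex.star_def, Complex.conj_ofReal]
  have hkey : ∀ χ ∈ s, M *ᵥ v χ = ((2 ^ n * r χ : ℝ) : ℂ) • v χ ∧
      (r χ = 0 ∨ r χ < 3 / ((2 : ℝ) ^ n + 2)) := by
    intro χ hχ
    rcases (hr0 χ).eq_or_lt with h0 | hpos
    · have hv0 : v χ = 0 := by
        rw [← dotProduct_star_self_eq_zero, hvv, ← h0, Complex.ofReal_zero]
      exact ⟨by simp [hv0], Or.inl h0.symm⟩
    -- A nonzero component `v χ` is normalized to a stabilizer vector, whose squared overlap with ψ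
    -- is again `r χ`.
    · set q : ℝ := (Real.sqrt (r χ))⁻¹ with hq
      have hqr : q * q * r χ = 1 := by
        rw [hq, ← mul_inv, Real.mul_self_sqrt hpos.le, inv_mul_cancel₀ hpos.ne']
      have hqrC : (q : ℂ) * q * r χ = 1 := by exact_mod_cast hqr
      have hq0 : (q : ℂ) ≠ 0 := by
        intro h; rw [h] at hqrC; simp at hqrC
      have hu : IsUnitVector ((q : ℂ) • v χ) := by
        rw [IsUnitVector, star_smul, smul_dotProduct, dotProduct_smul, hvv]
        simpa [mul_assoc] using hqrC
      have he : ∀ a : L, pauliOp (a : PauliLabel n) *ᵥ ((q : ℂ) • v χ) =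
          χ a • ((q : ℂ) • v χ) := fun a => by
        rw [Matrix.mulVec_smul, heig, smul_comm]
      have hF : ‖star ((q : ℂ) • v χ) ⬝ᵥ ψ‖ ^ 2 = r χ := by
        rw [star_smul, smul_dotProduct, hvψ χ hχ, Complex.star_def, Complex.conj_ofReal,
          smul_eq_mul, ← Complex.ofReal_mul, Complex.norm_real, Real.norm_eq_abs, sq_abs]
        linear_combination r χ * hqr
      have hMv := sum_pauliCoeff_smul_mulVec hL ψ hu he
      rw [hF, Matrix.mulVec_smul, smul_comm] at hMv
      refine ⟨smul_right_injective _ hq0 hMv, Or.inr ?_⟩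
      rw [← hF]
      exact hcon _ (isStabilizerVector_of_lagrangian hL hu he).1
  have hMψ : M *ᵥ ψ = ∑ χ ∈ s, ((2 ^ n * r χ : ℝ) : ℂ) • v χ := by
    rw [← hsum, Matrix.mulVec_sum]
    exact Finset.sum_congr rfl fun χ hχ => (hkey χ hχ).1
  -- The expectations of M and of M² in ψ are each computed twice: from the Pauli sum and from the
  -- spectral decomposition.
  have hfirst : ∑ a with a ∈ L, pauliCoeff ψ a ^ 2 = ∑ χ ∈ s, 2 ^ n * r χ ^ 2 := by
    have h : star ψ ⬝ᵥ M *ᵥ ψ = ((∑ a with a ∈ L, pauliCoeff ψ a ^ 2 : ℝ) : ℂ) := by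
      rw [hM, Matrix.sum_mulVec, dotProduct_sum]
      push_cast
      refine Finset.sum_congr rfl fun a _ => ?_
      rw [Matrix.smul_mulVec, dotProduct_smul, star_dotProduct_pauliOp_mulVec, smul_eq_mul, sq]
    rw [hMψ, dotProduct_sum] at h
    have h' : ∑ χ ∈ s, star ψ ⬝ᵥ ((2 ^ n * r χ : ℝ) : ℂ) • v χ =
        ((∑ χ ∈ s, 2 ^ n * r χ ^ 2 : ℝ) : ℂ) := by
      push_cast
      refine Finset.sum_congr rfl fun χ hχ => ?_
      rw [dotProduct_smul, hψv χ hχ, smul_eq_mul]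
      ring
    exact_mod_cast h.symm.trans h'
  have hsecond : ∑ a with a ∈ L, ∑ b with b ∈ L, pauliPairCoeff ψ a b =
      ∑ χ ∈ s, (2 ^ n) ^ 2 * r χ ^ 3 := by
    have h : (star ψ ⬝ᵥ (M * M) *ᵥ ψ).re =
        ∑ a with a ∈ L, ∑ b with b ∈ L, pauliPairCoeff ψ a b := by
      rw [hM, Finset.sum_mul_sum, Matrix.sum_mulVec, dotProduct_sum, Complex.re_sum]
      refine Finset.sum_congr rfl fun a _ => ?_
      rw [Matrix.sum_mulVec, dotProduct_sum, Complex.re_sum]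
      refine Finset.sum_congr rfl fun b _ => ?_
      rw [Matrix.smul_mul, Matrix.mul_smul, smul_smul, Matrix.smul_mulVec, dotProduct_smul,
        smul_eq_mul, ← Complex.ofReal_mul, Complex.re_ofReal_mul, pauliPairCoeff]
    have h' : star ψ ⬝ᵥ (M * M) *ᵥ ψ = ((∑ χ ∈ s, (2 ^ n) ^ 2 * r χ ^ 3 : ℝ) : ℂ) := by
      rw [← Matrix.mulVec_mulVec, hMψ, Matrix.mulVec_sum, dotProduct_sum]
      push_cast
      refine Finset.sum_congr rfl fun χ hχ => ?_
      rw [Matrix.mulVec_smul, (hkey χ hχ).1, dotProduct_smul, dotProduct_smul, hψv χ hχ]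
      push_cast [smul_eq_mul]
      ring
    rw [← h, h', Complex.ofReal_re]
  have htotal : ∑ χ ∈ s, r χ = 1 := by
    have h : star ψ ⬝ᵥ ψ = 1 := hψ
    have h' : star ψ ⬝ᵥ ψ = ((∑ χ ∈ s, r χ : ℝ) : ℂ) := by
      conv_lhs => rw [← hsum]
      rw [dotProduct_sum, hsum]
      push_cast
      exact Finset.sum_congr rfl hψv
    rw [h] at h'
    exact_mod_cast h'.symm
  obtain ⟨χ₀, hχ₀, hne⟩ := Finset.exists_ne_zero_of_sum_ne_zero (htotal ▸ one_ne_zero)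
  rw [hfirst, hsecond, Finset.mul_sum] at hmom
  -- If every nonzero r_χ were below 3/(d+2), then ∑ r_χ³ < 3/(d+2) ∑ r_χ². Strictness comes from
  -- one χ₀ with r ≠ 0, which exists because the r_χ sum to 1.
  refine absurd hmom (not_le.mpr (Finset.sum_lt_sum (fun χ hχ => ?_) ⟨χ₀, hχ₀, ?_⟩))
  · have e : (3 * 2 ^ n / (2 ^ n + 2) * (2 ^ n * r χ ^ 2) : ℝ) =
        (2 ^ n) ^ 2 * r χ ^ 2 * (3 / (2 ^ n + 2)) := by ring
    rw [e, pow_succ (r χ) 2, ← mul_assoc]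
    rcases (hkey χ hχ).2 with h | h
    · simp [h]
    · gcongr
  · have e : (3 * 2 ^ n / (2 ^ n + 2) * (2 ^ n * r χ₀ ^ 2) : ℝ) =
        (2 ^ n) ^ 2 * r χ₀ ^ 2 * (3 / (2 ^ n + 2)) := by ring
    rw [e, pow_succ (r χ₀) 2, ← mul_assoc]
    have h := (hkey χ₀ hχ₀).2.resolve_left hne
    have hpos : 0 < r χ₀ := lt_of_le_of_ne (hr0 _) (Ne.symm hne)
    gcongr

/-! ### A two-level witness and magic states of low purity -/

lemma expect_proj (W : Op n) (φ : Bits n → ℂ) : expect W (proj φ) = (star φ ⬝ᵥ W *ᵥ φ).re := by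
  rw [expect, proj, Matrix.mul_vecMulVec, Matrix.trace_vecMulVec, dotProduct_comm]

lemma expect_nonneg_of_stab {W : Op n}
    (hW : ∀ φ : Bits n → ℂ, IsStabilizerVector φ → 0 ≤ (star φ ⬝ᵥ W *ᵥ φ).re) :
    ∀ σ ∈ stab n, 0 ≤ expect W σ := by
  have hconv : Convex ℝ {σ : Op n | 0 ≤ expect W σ} := by
    intro σ hσ τ hτ a b ha hb _
    have hσ' : 0 ≤ (W * σ).trace.re := hσ
    have hτ' : 0 ≤ (W * τ).trace.re := hτ
    change 0 ≤ (W * (a • σ + b • τ)).trace.re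
    rw [Matrix.mul_add, Matrix.mul_smul, Matrix.mul_smul, Matrix.trace_add, Matrix.trace_smul,
      Matrix.trace_smul, Complex.add_re, Complex.smul_re, Complex.smul_re]
    positivity
  intro σ hσ
  refine convexHull_min ?_ hconv hσ
  rintro _ ⟨φ, hφ, rfl⟩
  change 0 ≤ expect W (proj φ)
  rw [expect_proj]
  exact hW φ hφ

lemma trace_one_op : (1 : Op n).trace = 2 ^ n := by
  simp [Matrix.trace_one]

/-- A Pauli-type witness supported on two computational basis vectors: up to a phase-space
relabelling it is `(I + X + Y + Z) / 2 ⊗ |0⟩⟨0|`. -/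
noncomputable def edgeWitness (x y : Bits n) : Op n :=
  Matrix.single x x 1 + Matrix.single x y ((1 - Complex.I) / 2) +
    Matrix.single y x ((1 + Complex.I) / 2)

/-- The projector onto the span of two computational basis vectors. -/
def edgeProj (x y : Bits n) : Op n := Matrix.single x x 1 + Matrix.single y y 1

section EdgeWitness

variable {x y : Bits n}

lemma edgeWitness_isHermitian : (edgeWitness x y).IsHermitian := by
  simp only [Matrix.IsHermitian, edgeWitness, Matrix.conjTranspose_add,
    Matrix.conjTranspose_single]
  have h1 : star ((1 - Complex.I) / 2) = (1 + Complex.I) / 2 := by simp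
  have h2 : star ((1 + Complex.I) / 2) = (1 - Complex.I) / 2 := by simp [sub_eq_add_neg]
  rw [h1, h2, star_one]
  abel

lemma edgeProj_isHermitian : (edgeProj x y).IsHermitian := by
  simp [Matrix.IsHermitian, edgeProj, Matrix.conjTranspose_single]

lemma edgeProj_mul_self (hxy : x ≠ y) : edgeProj x y * edgeProj x y = edgeProj x y := by
  simp [edgeProj, Matrix.add_mul, Matrix.mul_add, hxy, hxy.symm]

/-- On the two-dimensional block the witness is (I + S)/2 with S = X + Y + Z and S² = 3I. -/
lemma edgeWitness_mul_self (hxy : x ≠ y) :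
    edgeWitness x y * edgeWitness x y = edgeWitness x y + (1 / 2 : ℂ) • edgeProj x y := by
  have h1 : (1 - Complex.I) / 2 * ((1 + Complex.I) / 2) = 1 / 2 := by
    linear_combination (-1 / 4 : ℂ) * Complex.I_sq
  have h2 : (1 + Complex.I) / 2 * ((1 - Complex.I) / 2) = 1 / 2 := by rw [mul_comm, h1]
  simp only [edgeWitness, edgeProj, Matrix.add_mul, Matrix.mul_add, Matrix.single_mul_single_same,
    Matrix.single_mul_single_of_ne _ _ _ _ hxy, Matrix.single_mul_single_of_ne _ _ _ _ hxy.symm,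
    h1, h2, smul_add, Matrix.smul_single, one_mul, mul_one, smul_eq_mul, add_zero, zero_add]
  abel

lemma trace_edgeWitness (hxy : x ≠ y) : (edgeWitness x y).trace = 1 := by
  simp [edgeWitness, Matrix.trace_add, Matrix.trace_single_eq_same,
    Matrix.trace_single_eq_of_ne _ _ _ hxy, Matrix.trace_single_eq_of_ne _ _ _ hxy.symm]

lemma trace_edgeWitness_sq (hxy : x ≠ y) : (edgeWitness x y * edgeWitness x y).trace = 2 := by
  rw [edgeWitness_mul_self hxy, Matrix.trace_add, trace_edgeWitness hxy, Matrix.trace_smul]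
  simp [edgeProj, Matrix.trace_add, Matrix.trace_single_eq_same]
  norm_num

/-- If both amplitudes are nonzero, then φ y = ω φ x with ω a fourth root of unity. The expectation
is |φ x|² (1 + Re((1 − i)ω)), and the real part is ±1. -/
lemma edgeWitness_nonneg {φ : Bits n → ℂ} (hφ : IsStabilizerVector φ) :
    0 ≤ (star φ ⬝ᵥ edgeWitness x y *ᵥ φ).re := by
  have h : star φ ⬝ᵥ edgeWitness x y *ᵥ φ = star (φ x) * φ x +
      (1 - Complex.I) / 2 * (star (φ x) * φ y) + (1 + Complex.I) / 2 * (star (φ y) * φ x) := by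
    have hs : ∀ (i : Bits n) (c : ℂ),
        star φ ⬝ᵥ Function.update (0 : Bits n → ℂ) i c = star (φ i) * c :=
      fun i c => dotProduct_single (star φ) c i
    simp only [edgeWitness, Matrix.add_mulVec, dotProduct_add, Matrix.single_mulVec, hs]
    ring
  have hre : (star φ ⬝ᵥ edgeWitness x y *ᵥ φ).re = (φ x).re ^ 2 + (φ x).im ^ 2 +
      ((φ x).re * (φ y).re + (φ x).im * (φ y).im) +
      ((φ x).re * (φ y).im - (φ x).im * (φ y).re) := by
    rw [h]
    simp
    ring
  rw [hre]
  by_cases hx : φ x = 0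
  · simp [hx]
  by_cases hy : φ y = 0
  · simp only [hy, Complex.zero_re, Complex.zero_im]
    nlinarith [sq_nonneg (φ x).re, sq_nonneg (φ x).im]
  obtain ⟨k, hk⟩ := hφ.exists_eq_I_pow_mul hy hx
  have hI : Complex.I ^ k = 1 ∨ Complex.I ^ k = Complex.I ∨ Complex.I ^ k = -1 ∨
      Complex.I ^ k = -Complex.I := by
    rw [Complex.I_pow_eq_pow_mod]
    have : k % 4 < 4 := Nat.mod_lt _ (by norm_num)
    interval_cases k % 4 <;> simp [pow_succ]
  rcases hI with h | h | h | h <;> rw [h] at hk <;> rw [hk] <;> simp <;>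
    nlinarith [sq_nonneg (φ x).re, sq_nonneg (φ x).im]

/-- The line of Hermitian operators through the maximally mixed state orthogonal to the
hyperplane of the witness. -/
noncomputable def edgeState (x y : Bits n) (c : ℝ) : Op n :=
  (((1 + c) / 2 ^ n : ℝ) : ℂ) • (1 : Op n) - (c : ℂ) • edgeWitness x y

lemma edgeState_posSemidef (hxy : x ≠ y) {c : ℝ} (hc0 : 0 ≤ c)
    (hc : c * (3 / 2) ≤ (1 + c) / 2 ^ n) : (edgeState x y c).PosSemidef := by
  have h1 : ((1 - edgeWitness x y) * (1 - edgeWitness x y) : Op n).PosSemidef := by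
    have h := Matrix.posSemidef_conjTranspose_mul_self (1 - edgeWitness x y)
    rwa [Matrix.conjTranspose_sub, Matrix.conjTranspose_one, edgeWitness_isHermitian.eq] at h
  have h2 : ((1 - edgeProj x y) : Op n).PosSemidef := by
    have h := Matrix.posSemidef_conjTranspose_mul_self (1 - edgeProj x y)
    rw [Matrix.conjTranspose_sub, Matrix.conjTranspose_one, edgeProj_isHermitian.eq,
      Matrix.sub_mul, Matrix.mul_sub, Matrix.mul_sub, edgeProj_mul_self hxy] at h
    simpa using h
  -- This rests on 3/2 − W = (1 − W)² + (1 − E)/2, with E the block projector. The rational bound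
  -- 3/2 replaces the largest eigenvalue (1 + √3)/2 of W.
  have hdec : edgeState x y c =
      (((1 + c) / 2 ^ n - c * (3 / 2) : ℝ) : ℂ) • (1 : Op n) +
        ((c : ℂ) • ((1 - edgeWitness x y) * (1 - edgeWitness x y)) +
        ((c / 2 : ℝ) : ℂ) • (1 - edgeProj x y)) := by
    rw [Matrix.sub_mul, Matrix.mul_sub, Matrix.mul_sub, edgeWitness_mul_self hxy, edgeState]
    simp only [Matrix.one_mul, Matrix.mul_one]
    push_cast
    module
  rw [hdec]
  refine (Matrix.PosSemidef.one.smul ?_).add ((h1.smul ?_).add (h2.smul ?_))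
  · exact_mod_cast sub_nonneg.mpr hc
  · exact_mod_cast hc0
  · have : 0 ≤ c / 2 := by positivity
    exact_mod_cast this

lemma trace_edgeState (hxy : x ≠ y) (c : ℝ) : (edgeState x y c).trace = 1 := by
  rw [edgeState, Matrix.trace_sub, Matrix.trace_smul, Matrix.trace_smul, trace_one_op,
    trace_edgeWitness hxy]
  push_cast [smul_eq_mul]
  field_simp
  ring

lemma expect_edgeState (hxy : x ≠ y) (c : ℝ) :
    expect (edgeWitness x y) (edgeState x y c) = (1 + c) / 2 ^ n - 2 * c := by
  rw [expect, edgeState, Matrix.mul_sub, Matrix.mul_smul, Matrix.mul_smul, Matrix.mul_one,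
    Matrix.trace_sub, Matrix.trace_smul, Matrix.trace_smul, trace_edgeWitness hxy,
    trace_edgeWitness_sq hxy, smul_eq_mul, smul_eq_mul, Complex.sub_re, Complex.re_ofReal_mul,
    Complex.re_ofReal_mul]
  simp
  ring

lemma purity_edgeState (hxy : x ≠ y) (c : ℝ) :
    purity (edgeState x y c) = (1 + c) ^ 2 / 2 ^ n - 2 * c * (1 + c) / 2 ^ n + 2 * c ^ 2 := by
  have h : edgeState x y c * edgeState x y c =
      ((((1 + c) / 2 ^ n) ^ 2 : ℝ) : ℂ) • (1 : Op n) -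
        ((2 * c * ((1 + c) / 2 ^ n) : ℝ) : ℂ) • edgeWitness x y +
        ((c ^ 2 : ℝ) : ℂ) • (edgeWitness x y * edgeWitness x y) := by
    simp only [edgeState, Matrix.sub_mul, Matrix.mul_sub, Matrix.smul_mul, Matrix.mul_smul,
      Matrix.one_mul, Matrix.mul_one]
    push_cast
    module
  have h' : (edgeState x y c * edgeState x y c).trace =
      (((1 + c) ^ 2 / 2 ^ n - 2 * c * (1 + c) / 2 ^ n + 2 * c ^ 2 : ℝ) : ℂ) := by
    rw [h, Matrix.trace_add, Matrix.trace_sub, Matrix.trace_smul, Matrix.trace_smul,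
      Matrix.trace_smul, trace_one_op, trace_edgeWitness hxy, trace_edgeWitness_sq hxy]
    push_cast [smul_eq_mul]
    field_simp
  rw [purity, h', Complex.ofReal_re]

lemma edgeState_isMagic (hxy : x ≠ y) {c : ℝ} (hc0 : 0 ≤ c)
    (hc : c * (3 / 2) ≤ (1 + c) / 2 ^ n) (hneg : (1 + c) / 2 ^ n < 2 * c) :
    IsMagic (edgeState x y c) := by
  refine ⟨⟨edgeState_posSemidef hxy hc0 hc, trace_edgeState hxy c⟩, fun hmem => ?_⟩
  have h := expect_nonneg_of_stab (fun φ hφ => edgeWitness_nonneg (x := x) (y := y) hφ) _ hmem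
  rw [expect_edgeState hxy] at h
  linarith

end EdgeWitness

/-- There are magic states of purity arbitrarily close to `1 / (d - 1 / 2)`. -/
theorem exists_magic_purity_near (hn : 1 ≤ n) {ε : ℝ} (hε : 0 < ε) :
    ∃ ρ : Op n, IsMagic ρ ∧ |purity ρ - 1 / ((2 : ℝ) ^ n - 1 / 2)| < ε := by
  have hxy : (0 : Bits n) ≠ Pi.single ⟨0, hn⟩ 1 := by
    intro h
    have := congrFun h ⟨0, hn⟩
    simp at this
  set d : ℝ := 2 ^ n with hd
  have hd2 : 2 ≤ d := by
    rw [hd]; calc (2 : ℝ) = 2 ^ 1 := by norm_num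
      _ ≤ 2 ^ n := pow_le_pow_right₀ (by norm_num) hn
  -- At `c₀` the line of states meets the hyperplane Tr(Wρ) = 0.
  set c₀ : ℝ := 1 / (2 * d - 1) with hc₀
  have hpos : 0 < 2 * d - 1 := by linarith
  have hc₀pos : 0 < c₀ := by positivity
  set f : ℝ → ℝ := fun c => (1 + c) ^ 2 / d - 2 * c * (1 + c) / d + 2 * c ^ 2 with hf
  have hfc : f c₀ = 1 / (d - 1 / 2) := by
    have h1 : d - 1 / 2 ≠ 0 := by linarith
    have h2 : d ≠ 0 := by linarith
    have h3 : (d - 1 / 2) = (2 * d - 1) / 2 := by ring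
    simp only [hf, hc₀]
    rw [h3]
    field_simp
    ring
  have hcont : Continuous f := by fun_prop
  obtain ⟨η, hη, hball⟩ := Metric.continuousAt_iff.mp (hcont.continuousAt (x := c₀)) ε hε
  -- Up to `c₁` the positivity criterion holds; as c₀ < c₁, states slightly beyond the hyperplane
  -- are available.
  set c₁ : ℝ := 2 / (3 * d - 2) with hc₁
  have hpos' : 0 < 3 * d - 2 := by linarith
  have hlt : c₀ < c₁ := by
    rw [hc₀, hc₁, div_lt_div_iff₀ hpos hpos']
    linarith
  obtain ⟨c, hcl, hcr⟩ := exists_between (lt_min hlt (lt_add_of_pos_right c₀ hη))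
  obtain ⟨hcr1, hcr2⟩ := lt_min_iff.mp hcr
  have hdpos : 0 < d := by linarith
  refine ⟨edgeState 0 (Pi.single ⟨0, hn⟩ 1) c, edgeState_isMagic hxy (by linarith) ?_ ?_, ?_⟩
  · rw [← hd, le_div_iff₀ hdpos]
    rw [hc₁, lt_div_iff₀ hpos'] at hcr1
    linarith
  · rw [← hd, div_lt_iff₀ hdpos]
    rw [hc₀, div_lt_iff₀ hpos] at hcl
    linarith
  · rw [purity_edgeState hxy, ← hd, ← hfc]
    have := @hball c (by rw [Real.dist_eq, abs_of_pos (by linarith)]; linarith)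
    rwa [Real.dist_eq] at this

/-! ### Low purity and fidelity witnesses -/

/-- The Hilbert-Schmidt Cauchy-Schwarz inequality between the traceless parts of `ρ` and
`|ψ⟩⟨ψ|`. -/
lemma fidelity_sub_sq_le {ρ : Op n} (hρ : IsState ρ) {ψ : Bits n → ℂ} (hψ : IsUnitVector ψ) :
    (fidelity ρ ψ - 1 / 2 ^ n) ^ 2 ≤ (purity ρ - 1 / 2 ^ n) * (1 - 1 / 2 ^ n) := by
  set d : ℝ := 2 ^ n with hd
  have hd1 : 1 ≤ d := one_le_pow₀ (by norm_num)
  have htrψ : (proj ψ).trace = 1 := by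
    rw [proj, Matrix.trace_vecMulVec, dotProduct_comm]; exact hψ
  have hψψ : proj ψ * proj ψ = proj ψ := by
    rw [proj, Matrix.vecMulVec_mul_vecMulVec, show star ψ ⬝ᵥ ψ = 1 from hψ, one_smul]
  have hfid : (ρ * proj ψ).trace.re = fidelity ρ ψ := by
    rw [← expect, expect_proj, fidelity]
  have hfid' : (proj ψ * ρ).trace.re = fidelity ρ ψ := by
    rw [Matrix.trace_mul_comm, hfid]
  have hψherm : (proj ψ).IsHermitian := by
    rw [Matrix.IsHermitian, proj, Matrix.conjTranspose_vecMulVec, star_star]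
  have key : ∀ s t : ℝ, 0 ≤ purity ρ + s ^ 2 + t ^ 2 * d + 2 * s * fidelity ρ ψ + 2 * t +
      2 * s * t := by
    intro s t
    set A : Op n := ρ + (s : ℂ) • proj ψ + (t : ℂ) • (1 : Op n) with hA
    have hAh : Aᴴ = A := by
      simp [hA, Matrix.conjTranspose_add, Matrix.conjTranspose_smul, hρ.1.isHermitian.eq,
        hψherm.eq]
    have h := (Matrix.posSemidef_conjTranspose_mul_self A).trace_nonneg
    rw [hAh] at h
    have hAA : A * A = ρ * ρ + ((s ^ 2 : ℝ) : ℂ) • proj ψ + ((t ^ 2 : ℝ) : ℂ) • (1 : Op n) +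
        (s : ℂ) • (ρ * proj ψ) + (s : ℂ) • (proj ψ * ρ) + ((2 * t : ℝ) : ℂ) • ρ +
        ((2 * s * t : ℝ) : ℂ) • proj ψ := by
      simp only [hA, Matrix.add_mul, Matrix.mul_add, Matrix.smul_mul, Matrix.mul_smul,
        Matrix.one_mul, Matrix.mul_one, hψψ]
      push_cast
      module
    have h' := (Complex.le_def.mp h).1
    rw [hAA] at h'
    simp only [Matrix.trace_add, Matrix.trace_smul, smul_eq_mul, Complex.add_re,
      Complex.re_ofReal_mul, htrψ, hρ.2, hfid, hfid', trace_one_op, Complex.zero_re] at h'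
    have h2 : ((2 : ℂ) ^ n).re = d := by
      rw [hd, show (2 : ℂ) ^ n = ((2 ^ n : ℝ) : ℂ) by push_cast; rfl, Complex.ofReal_re]
    rw [h2] at h'
    simp only [Complex.one_re] at h'
    rw [purity]
    linarith
  have hd0 : 0 < d := by linarith
  have hreduced : ∀ s : ℝ, 0 ≤ (purity ρ - 1 / d) + 2 * s * (fidelity ρ ψ - 1 / d) +
      s ^ 2 * (1 - 1 / d) := by
    intro s
    -- This t makes ρ + s|ψ⟩⟨ψ| + tI traceless, which minimizes its Hilbert-Schmidt norm for given
    -- s. The discriminant in s then gives the inequality.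
    have h := key s (-(1 + s) / d)
    have e : purity ρ + s ^ 2 + (-(1 + s) / d) ^ 2 * d + 2 * s * fidelity ρ ψ +
        2 * (-(1 + s) / d) + 2 * s * (-(1 + s) / d) =
        (purity ρ - 1 / d) + 2 * s * (fidelity ρ ψ - 1 / d) + s ^ 2 * (1 - 1 / d) := by
      field_simp
      ring
    rwa [e] at h
  have hdisc := discrim_le_zero (a := 1 - 1 / d) (b := 2 * (fidelity ρ ψ - 1 / d))
    (c := purity ρ - 1 / d) (fun s => by
      have := hreduced s
      linarith)
  rw [discrim] at hdisc
  linarith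

/-- States of small purity have small fidelity with every pure state. -/
lemma fidelity_lt_of_purity_lt (hn : 1 ≤ n) {ρ : Op n} (hρ : IsState ρ)
    (hp : purity ρ < 1 / 2 ^ n + 4 * (2 ^ n - 1) / (2 ^ n * (2 ^ n + 2) ^ 2))
    {ψ : Bits n → ℂ} (hψ : IsUnitVector ψ) : fidelity ρ ψ < 3 / ((2 : ℝ) ^ n + 2) := by
  have h := fidelity_sub_sq_le hρ hψ
  set d : ℝ := 2 ^ n with hd
  have hd2 : 2 ≤ d := by
    rw [hd]; calc (2 : ℝ) = 2 ^ 1 := by norm_num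
      _ ≤ 2 ^ n := pow_le_pow_right₀ (by norm_num) hn
  by_contra! hcon
  have hd0 : 0 < d := by linarith
  -- The purity bound in the hypothesis is the value at which Cauchy-Schwarz would allow a fidelity
  -- of exactly 3/(d+2).
  have e1 : 3 / (d + 2) - 1 / d = 2 * (d - 1) / (d * (d + 2)) := by
    field_simp
    ring
  have h1 : 0 ≤ 2 * (d - 1) / (d * (d + 2)) := by
    have : 0 ≤ d - 1 := by linarith
    positivity
  have h2 : (2 * (d - 1) / (d * (d + 2))) ^ 2 ≤ (fidelity ρ ψ - 1 / d) ^ 2 :=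
    pow_le_pow_left₀ h1 (by linarith) 2
  have h3 : (purity ρ - 1 / d) * (1 - 1 / d) <
      4 * (d - 1) / (d * (d + 2) ^ 2) * (1 - 1 / d) := by
    refine mul_lt_mul_of_pos_right (by linarith) ?_
    rw [sub_pos, div_lt_one hd0]
    linarith
  have h4 : 4 * (d - 1) / (d * (d + 2) ^ 2) * (1 - 1 / d) =
      (2 * (d - 1) / (d * (d + 2))) ^ 2 := by
    field_simp
    ring
  linarith

/-- Since the trace is 1, detection means that the fidelity exceeds α. -/
lemma expect_fidelityOp (α : ℝ) (ψ : Bits n → ℂ) {ρ : Op n} (hρ : ρ.trace = 1) :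
    expect (fidelityOp α ψ) ρ = α - fidelity ρ ψ := by
  have h : (proj ψ * ρ).trace.re = fidelity ρ ψ := by
    rw [Matrix.trace_mul_comm, ← expect, expect_proj, fidelity]
  rw [expect, fidelityOp, Matrix.sub_mul, Matrix.smul_mul, Matrix.one_mul, Matrix.trace_sub,
    Matrix.trace_smul, hρ, Complex.sub_re, h]
  simp

lemma fidelity_proj (φ ψ : Bits n → ℂ) : fidelity (proj φ) ψ = ‖star φ ⬝ᵥ ψ‖ ^ 2 := by
  rw [fidelity, proj_mulVec, dotProduct_smul, Matrix.star_dotProduct ψ φ, smul_eq_mul,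
    Complex.star_def, Complex.mul_conj', ← Complex.ofReal_pow, Complex.ofReal_re]

/-- Fidelity witnesses only detect states of fidelity above the universal threshold. -/
lemma not_detectedByFidelity {ρ : Op n} (hρ : IsState ρ)
    (h : ∀ ψ : Bits n → ℂ, IsUnitVector ψ → fidelity ρ ψ < 3 / ((2 : ℝ) ^ n + 2)) :
    ¬ DetectedByFidelity ρ := by
  rintro ⟨α, ψ, hψ, hW, hneg⟩
  obtain ⟨φ, hφ, hge⟩ := exists_stabilizer_fidelity_ge hψ
  have htr : (proj φ).trace = 1 := by
    rw [proj, Matrix.trace_vecMulVec, dotProduct_comm]; exact hφ.1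
  have h1 := hW.2.1 (proj φ) (subset_convexHull ℝ _ ⟨φ, hφ, rfl⟩)
  rw [expect_fidelityOp α ψ htr, fidelity_proj] at h1
  rw [expect_fidelityOp α ψ hρ.2] at hneg
  linarith [h ψ hψ]

/-- States of purity close to `1 / (d - 1 / 2)` are not detected by fidelity witnesses. -/
theorem exists_undetected_purity_radius (hn : 2 ≤ n) :
    ∃ δ : ℝ, 0 < δ ∧ ∀ ρ : Op n, IsState ρ → purity ρ < 1 / ((2 : ℝ) ^ n - 1 / 2) + δ →
      (∀ ψ : Bits n → ℂ, IsUnitVector ψ → fidelity ρ ψ < 3 / ((2 : ℝ) ^ n + 2)) ∧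
      ¬ DetectedByFidelity ρ := by
  have hd4 : (4 : ℝ) ≤ 2 ^ n := by
    calc (4 : ℝ) = 2 ^ 2 := by norm_num
      _ ≤ 2 ^ n := pow_le_pow_right₀ (by norm_num) hn
  -- δ is the gap between the Cauchy-Schwarz threshold and 1/(d − 1/2). Its sign is that of 7d − 16,
  -- positive for d ≥ 4 but negative for d = 2.
  refine ⟨1 / 2 ^ n + 4 * (2 ^ n - 1) / (2 ^ n * (2 ^ n + 2) ^ 2) - 1 / (2 ^ n - 1 / 2), ?_,
    fun ρ hρ hp => ?_⟩
  · generalize (2 : ℝ) ^ n = d at hd4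
    have h1 : 0 < d - 1 / 2 := by linarith
    have h2 : 0 < d := by linarith
    have e : 1 / d + 4 * (d - 1) / (d * (d + 2) ^ 2) - 1 / (d - 1 / 2) =
        d * (7 * d - 16) / (d * (d + 2) ^ 2 * (2 * (d - 1 / 2))) := by
      rw [div_add_div _ _ h2.ne' (by positivity), div_sub_div _ _ (by positivity) h1.ne',
        div_eq_div_iff (by positivity) (by positivity)]
      ring
    rw [e]
    have h3 : 0 < 7 * d - 16 := by linarith
    positivity
  · have hf : ∀ ψ : Bits n → ℂ, IsUnitVector ψ → fidelity ρ ψ < 3 / ((2 : ℝ) ^ n + 2) :=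
      fun ψ hψ => fidelity_lt_of_purity_lt (by omega) hρ (by linarith) hψ
    exact ⟨hf, not_detectedByFidelity hρ hf⟩

end UnfaithfulMagic

theorem theorem7 :
    -- every pure state has stabilizer fidelity at least 3 / (d + 2)
    (∀ (n : ℕ) (ψ : UnfaithfulMagic.Bits n → ℂ), UnfaithfulMagic.IsUnitVector ψ →
      ∃ φ : UnfaithfulMagic.Bits n → ℂ, UnfaithfulMagic.IsStabilizerVector φ ∧
        3 / ((2 : ℝ) ^ n + 2) ≤ ‖star φ ⬝ᵥ ψ‖ ^ 2) ∧
    (∀ n : ℕ, 2 ≤ n →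
      -- there are magic states of purity arbitrarily close to 1 / (d - 1/2)
      (∀ ε : ℝ, 0 < ε → ∃ ρ : UnfaithfulMagic.Op n, UnfaithfulMagic.IsMagic ρ ∧
        |UnfaithfulMagic.purity ρ - 1 / ((2 : ℝ) ^ n - 1 / 2)| < ε) ∧
      -- states of purity close to that value are below the threshold and remain undetected
      (∃ δ : ℝ, 0 < δ ∧ ∀ ρ : UnfaithfulMagic.Op n, UnfaithfulMagic.IsState ρ →
        UnfaithfulMagic.purity ρ < 1 / ((2 : ℝ) ^ n - 1 / 2) + δ →
        (∀ ψ : UnfaithfulMagic.Bits n → ℂ, UnfaithfulMagic.IsUnitVector ψ →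
          UnfaithfulMagic.fidelity ρ ψ < 3 / ((2 : ℝ) ^ n + 2)) ∧
        ¬ UnfaithfulMagic.DetectedByFidelity ρ) ∧
      -- unfaithful magic states exist
      (∃ ρ : UnfaithfulMagic.Op n, UnfaithfulMagic.IsMagic ρ ∧
        ¬ UnfaithfulMagic.DetectedByFidelity ρ)) := by
  refine ⟨fun n ψ hψ => UnfaithfulMagic.exists_stabilizer_fidelity_ge hψ, fun n hn => ?_⟩
  obtain ⟨δ, hδ, hund⟩ := UnfaithfulMagic.exists_undetected_purity_radius hn
  have hmagic := fun (ε : ℝ) (hε : 0 < ε) =>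
    UnfaithfulMagic.exists_magic_purity_near (n := n) (by omega) hε
  refine ⟨hmagic, ⟨δ, hδ, hund⟩, ?_⟩
  obtain ⟨ρ, hρ, hclose⟩ := hmagic δ hδ
  exact ⟨ρ, hρ, (hund ρ hρ.1 (by linarith [(abs_lt.mp hclose).2])).2⟩
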